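/- Let $\mathbb{L}$ be a smooth finite-dimensional (Hausdorff) manifold and $\mathfrak{l}$ a finite-dimensional real vector space, and let $\rho:\mathbb{L}\times\mathfrak{l}\to T\mathbb{L}$, $(p,\xi)\mapsto\rho_p(\xi)\in T_p\mathbb{L}$, be a diffeomorphism such that each $\rho_p:\mathfrak{l}\to T_p\mathbb{L}$ is a linear isomorphism. For $\xi\in\mathfrak{l}$ let $\rho(\xi)$ be the vector field $p\mapsto\rho_p(\xi)$ (a fundamental vector field), and suppose that all fundamental vector fields are complete. Write $\xi\cdot s=\Phi_{\xi,1}(s)$, where $\Phi_{\xi,t}$ is the flow of $\rho(\xi)$, and $R_s(\xi)=\xi\cdot s$. For $s\in\mathbb{L}$ and $\xi,\eta,\gamma\in\mathfrak{l}$ define $$[\xi,\eta]^{(s)}=-\rho_s^{-1}\big([\rho(\xi),\rho(\eta)]_s\big),\qquad b(\xi,\eta)(s)=[\xi,\eta]^{(s)},\qquad a^{(s)}(\xi,\eta,\gamma)=\big(d_{\rho(\gamma)}b(\xi,\eta)\big)(s),$$ where $[\rho(\xi),\rho(\eta)]$ is the Lie bracket of vector fields. Then, for every $s\in\mathbb{L}$,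 $R_s$ is a local diffeomorphism at $0$, and the functions $b(\xi,\eta):\mathbb{L}\to\mathfrak{l}$ are smooth. Let $p\mapsto p/s$ denote the inverse of the restriction of $R_s$ to any open neighbourhood of $0$ that $R_s$ maps diffeomorphically onto an open neighbourhood of $s$, and put $$\xi\circ_s\eta=\big(\xi\cdot(\eta\cdot s)\big)/s$$ for $\xi,\eta\in\mathfrak{l}$ near $0$. The product $\circ_s$ is smooth near $(0,0)$, and for all $\xi,\eta,\gamma\in\mathfrak{l}$ $$[\xi,\eta]^{(s)}=\left.\frac{d^2}{dt_1dt_2}\Big((t_1\xi)\circ_s(t_2\eta)-(t_2\eta)\circ_s(t_1\xi)\Big)\right|_{t_1=t_2=0},$$ $$a^{(s)}(\xi,\eta,\gamma)=[\xi,\eta,\gamma]^{(s)}-[\eta,\xi,\gamma]^{(s)},$$ where $$[\xi,\eta,\gamma]^{(s)}=\left.\frac{d^3}{dt_1dt_2dt_3}\Big((t_1\xi)\circ_s\big((t_2\eta)\circ_s(t_3\gamma)\big)-\big((t_1\xi)\circ_s(t_2\eta)\big)\circ_s(t_3\gamma)\Big)\right|_{t_1=t_2=t_3=0}.$$ -/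

import Mathlib

open scoped Manifold ContDiff Topology

noncomputable section

/-- A trivialization `ρ` of the tangent bundle of the smooth manifold `L` (modelled on `E`) with
model fibre the vector space `𝔩`: linear isomorphisms `ρ_p : 𝔩 ≃ T_p L` such that
`(p, ξ) ↦ ρ_p ξ` is a diffeomorphism `L × 𝔩 → TL`, that is, it and its inverse
`v ↦ (p, ρ_p⁻¹ v)`, `v ∈ T_p L`, are smooth. -/
structure Parallelization (E : Type*) [NormedAddCommGroup E] [NormedSpace ℝ E]
    (L : Type*) [TopologicalSpace L] [ChartedSpace E L] [IsManifold 𝓘(ℝ, E) ∞ L]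
    (𝔩 : Type*) [NormedAddCommGroup 𝔩] [NormedSpace ℝ 𝔩] where
  /-- The linear isomorphism `ρ_p`. -/
  ρ : ∀ p : L, 𝔩 ≃ₗ[ℝ] TangentSpace 𝓘(ℝ, E) p
  smooth_toFun : ContMDiff (𝓘(ℝ, E).prod 𝓘(ℝ, 𝔩)) 𝓘(ℝ, E).tangent ∞
    (fun x : L × 𝔩 => (⟨x.1, ρ x.1 x.2⟩ : TangentBundle 𝓘(ℝ, E) L))
  smooth_invFun : ContMDiff 𝓘(ℝ, E).tangent (𝓘(ℝ, E).prod 𝓘(ℝ, 𝔩)) ∞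
    (fun v : TangentBundle 𝓘(ℝ, E) L => ((v.1, (ρ v.1).symm v.2) : L × 𝔩))

namespace Parallelization

variable {E : Type*} [NormedAddCommGroup E] [NormedSpace ℝ E]
  {L : Type*} [TopologicalSpace L] [ChartedSpace E L] [IsManifold 𝓘(ℝ, E) ∞ L]
  {𝔩 : Type*} [NormedAddCommGroup 𝔩] [NormedSpace ℝ 𝔩]

/-- The fundamental vector field `ρ(ξ)`. -/
def fundamental (P : Parallelization E L 𝔩) (ξ : 𝔩) (p : L) : TangentSpace 𝓘(ℝ, E) p :=
  P.ρ p ξ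

/-- The trivialization is complete: every fundamental vector field has, through every point,
an integral curve defined on the whole of `ℝ`. -/
def IsComplete (P : Parallelization E L 𝔩) : Prop :=
  ∀ (ξ : 𝔩) (s : L), ∃ c : ℝ → L, c 0 = s ∧ IsMIntegralCurve c (P.fundamental ξ)

open Classical in
/-- The flow `Φ_{ξ,t}(s)` of `ρ(ξ)`: the value at time `t` of the integral curve of `ρ(ξ)`
defined on `ℝ` and starting at `s` (with the value `s` if there is no such curve). On a Hausdorff
manifold the integral curve is unique. -/
def flow (P : Parallelization E L 𝔩) (ξ : 𝔩) (t : ℝ) (s : L) : L :=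
  if h : ∃ c : ℝ → L, c 0 = s ∧ IsMIntegralCurve c (P.fundamental ξ) then h.choose t else s

/-- The product `ξ · s = Φ_{ξ,1}(s)` of `ξ ∈ 𝔩` and `s ∈ L`. -/
def act (P : Parallelization E L 𝔩) (ξ : 𝔩) (s : L) : L := P.flow ξ 1 s

/-- The right product map `R_s : 𝔩 → L`, `R_s(ξ) = ξ · s`. -/
def rightMul (P : Parallelization E L 𝔩) (s : L) (ξ : 𝔩) : L := P.act ξ s

/-- `Φ` is a local inversion of `R_s` near `0`: a diffeomorphism from an open neighbourhood of `0`
in `𝔩` onto an open subset of `L` on which it agrees with `R_s`. Its inverse is the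
right quotient `p ↦ p / s`. -/
def IsLocalInversion (P : Parallelization E L 𝔩) (s : L)
    (Φ : PartialDiffeomorph 𝓘(ℝ, 𝔩) 𝓘(ℝ, E) 𝔩 L ∞) : Prop :=
  (0 : 𝔩) ∈ Φ.source ∧ Set.EqOn (P.rightMul s) Φ Φ.source

/-- The local loop product `ξ ∘_s η = (ξ · (η · s)) / s` on `𝔩`, where `p / s = Φ⁻¹(p)`
for a local inversion `Φ` of `R_s`. It is meaningful for `ξ, η` near `0`. -/
def loopMul (P : Parallelization E L 𝔩) (s : L)
    (Φ : PartialDiffeomorph 𝓘(ℝ, 𝔩) 𝓘(ℝ, E) 𝔩 L ∞) (ξ η : 𝔩) : 𝔩 :=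
  Φ.symm (P.act ξ (P.act η s))

/-- The bracket `[ξ, η]^{(s)} = -ρ_s⁻¹([ρ(ξ), ρ(η)]_s)`; as a function of `s` this is
the bracket function `b(ξ, η)`. -/
def bracket (P : Parallelization E L 𝔩) (s : L) (ξ η : 𝔩) : 𝔩 :=
  -(P.ρ s).symm (VectorField.mlieBracket 𝓘(ℝ, E) (P.fundamental ξ) (P.fundamental η) s)

/-- The skew-associator `a^{(s)}(ξ, η, γ) = d_{ρ(γ)} b(ξ, η)` at `s`. -/
def skewAssociator (P : Parallelization E L 𝔩) (s : L) (ξ η γ : 𝔩) : 𝔩 :=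
  mfderiv 𝓘(ℝ, E) 𝓘(ℝ, 𝔩) (fun p : L => P.bracket p ξ η) s (P.fundamental γ s)

/-- The infinitesimal associator `[ξ, η, γ]^{(s)}` of `∘_s`. -/
def infAssociator (P : Parallelization E L 𝔩) (s : L)
    (Φ : PartialDiffeomorph 𝓘(ℝ, 𝔩) 𝓘(ℝ, E) 𝔩 L ∞) (ξ η γ : 𝔩) : 𝔩 :=
  deriv (fun t₁ : ℝ => deriv (fun t₂ : ℝ => deriv (fun t₃ : ℝ =>
    P.loopMul s Φ (t₁ • ξ) (P.loopMul s Φ (t₂ • η) (t₃ • γ))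
      - P.loopMul s Φ (P.loopMul s Φ (t₁ • ξ) (t₂ • η)) (t₃ • γ)) 0) 0) 0

end Parallelization

end

/-! Analytic part: `(ξ, p) ↦ ξ · p` is smooth. Near `ξ = 0` a chart turns this into smooth parameter
dependence of an ODE solution up to time `1`, obtained from the inverse function theorem on a Banach
space of curves (`exists_contDiffAt_flow`). For large `ξ` the time-one flow is a composition of
short-time flows along a compact piece of orbit (`IsComplete.contMDiff_act`). The derivative of
`R_s` at `0` is `ρ_s`, hence `R_s` is a local diffeomorphism there, and `∘_s` is a smooth local
product `m` with two-sided unit `0`.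

Algebraic part: let `A(y)` and `B(x)` be the derivatives of `m(·, y)` and `m(x, ·)` at `0`. Since `t
↦ (tξ) · p` is the integral curve of `ρ(ξ)` through `p`, the field `y ↦ A(y)ξ` is the pull-back of
`ρ(ξ)` along `Φ`. Naturality of the Lie bracket gives, for `β(y) = b(ξ, η)(Φ y)`, the structure
equation `A(y) β(y) = A'(y)(A(y)η) ξ - A'(y)(A(y)ξ) η`. At `y = 0`, where `A = id`, this is the
formula for the bracket. Its derivative at `0` along `γ` gives `β'(0)γ + A'(0)γ (β(0))` on the left.
On the right stand the skew-symmetrized third derivatives of `ξ(ηγ)`. Those of `(ξη)γ`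
skew-symmetrize to `A'(0)γ (β(0))`, because `B'(0)ξ η = A'(0)η ξ` and the second derivative of
`B(·)γ` is symmetric. The difference is the formula for the skew-associator (`associatorDeriv_sub`).
-/

noncomputable section

open Set Filter MeasureTheory

universe u v

/-! ### Smooth composition operators on spaces of continuous curves -/

namespace ContinuousMap

variable {K : Type*} [TopologicalSpace K] [CompactSpace K]

/-- Pointwise application of a continuous family of operators to a continuous family of vectors,
as a continuous bilinear map. -/
def applyBilin (K : Type*) [TopologicalSpace K] [CompactSpace K]
    (E F : Type*) [NormedAddCommGroup E] [NormedSpace ℝ E]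
    [NormedAddCommGroup F] [NormedSpace ℝ F] :
    C(K, E →L[ℝ] F) →L[ℝ] C(K, E) →L[ℝ] C(K, F) :=
  LinearMap.mkContinuous₂
    (LinearMap.mk₂ ℝ (fun (A : C(K, E →L[ℝ] F)) (w : C(K, E)) =>
        (⟨fun t => A t (w t), by fun_prop⟩ : C(K, F)))
      (fun _ _ _ => by ext; simp) (fun _ _ _ => by ext; simp)
      (fun _ _ _ => by ext; simp) (fun _ _ _ => by ext; simp))
    1 fun A w => by
      rw [one_mul, ContinuousMap.norm_le _ (by positivity)]
      intro t
      exact ((A t).le_opNorm (w t)).trans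
        (mul_le_mul (A.norm_coe_le_norm t) (w.norm_coe_le_norm t) (norm_nonneg _) (norm_nonneg A))

@[simp] lemma applyBilin_apply {E F : Type*} [NormedAddCommGroup E] [NormedSpace ℝ E]
    [NormedAddCommGroup F] [NormedSpace ℝ F] (A : C(K, E →L[ℝ] F)) (w : C(K, E)) (t : K) :
    applyBilin K E F A w t = A t (w t) := rfl

/-- The embedding of constants as a continuous linear map. -/
def constCLM (K : Type*) [TopologicalSpace K] [CompactSpace K]
    (E : Type*) [NormedAddCommGroup E] [NormedSpace ℝ E] : E →L[ℝ] C(K, E) :=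
  LinearMap.mkContinuous
    { toFun := ContinuousMap.const K, map_add' := fun _ _ => rfl, map_smul' := fun _ _ => rfl } 1
    fun x => by
      rw [one_mul, ContinuousMap.norm_le _ (norm_nonneg _)]
      exact fun _ => le_rfl

@[simp] lemma constCLM_apply {E : Type*} [NormedAddCommGroup E] [NormedSpace ℝ E]
    (x : E) (t : K) : constCLM K E x t = x := rfl

/-- A continuously differentiable function induces a differentiable composition operator. -/
theorem hasFDerivAt_comp_left {E F : Type*} [NormedAddCommGroup E] [NormedSpace ℝ E]
    [NormedAddCommGroup F] [NormedSpace ℝ F] (f : C(E, F)) (f' : C(E, E →L[ℝ] F))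
    (hf : ∀ x, HasFDerivAt f (f' x) x) (w : C(K, E)) :
    HasFDerivAt (fun w : C(K, E) => f.comp w) (applyBilin K E F (f'.comp w)) w := by
  rw [hasFDerivAt_iff_isLittleO_nhds_zero, Asymptotics.isLittleO_iff]
  intro c hc
  -- Although `E` need not be locally compact, `f'` is uniformly continuous near the compact range
  -- of `w`. This makes the mean value estimate below uniform in `t`.
  have hU := (isCompact_range w.continuous).uniformContinuousAt_of_continuousAt f'
    (fun a _ => f'.continuous.continuousAt) (Metric.dist_mem_uniformity hc)
  obtain ⟨δ, hδ, hδU⟩ := Metric.mem_uniformity_dist.1 hU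
  filter_upwards [Metric.ball_mem_nhds (0 : C(K, E)) hδ] with h hh
  rw [mem_ball_zero_iff] at hh
  rw [ContinuousMap.norm_le _ (by positivity)]
  intro t
  have hht : ‖h t‖ < δ := (h.norm_coe_le_norm t).trans_lt hh
  have key := (convex_ball (w t) δ).norm_image_sub_le_of_norm_hasFDerivWithin_le' (f := f) (f' := f')
    (φ := f' (w t)) (C := c) (x := w t) (y := w t + h t)
    (fun x _ => (hf x).hasFDerivWithinAt)
    (fun x hx => by
      have := hδU (a := w t) (b := x) (by rwa [dist_comm]) (mem_range_self t)
      simp only [mem_ofPred_eq, dist_eq_norm] at this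
      rw [norm_sub_rev]; exact this.le)
    (Metric.mem_ball_self hδ) (by simpa using hht)
  rw [add_sub_cancel_left] at key
  exact key.trans (mul_le_mul_of_nonneg_left (h.norm_coe_le_norm t) hc.le)

/-- A `C^n` function induces a `C^n` composition operator. -/
theorem contDiff_comp_left_nat {E : Type u} [NormedAddCommGroup E] [NormedSpace ℝ E] (n : ℕ) :
    ∀ {F : Type (max u v)} [NormedAddCommGroup F] [NormedSpace ℝ F] (f : C(E, F)),
      ContDiff ℝ n f → ContDiff ℝ n (fun w : C(K, E) => f.comp w) := by
  -- The induction must vary `F`, since the derivative takes values in `E →L[ℝ] F`; the universe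
  -- `max u v` is stable under this passage.
  induction n with
  | zero =>
    intro F _ _ f _
    exact contDiff_zero.2 (ContinuousMap.continuous_postcomp f)
  | succ n ih =>
    intro F _ _ f hf
    have hf1 : ContDiff ℝ 1 f := hf.of_le (by exact_mod_cast Nat.le_add_left 1 n)
    let f' : C(E, E →L[ℝ] F) := ⟨fderiv ℝ f, hf1.continuous_fderiv one_ne_zero⟩
    have hd := hasFDerivAt_comp_left (K := K) f f'
      (fun x => (hf1.differentiable one_ne_zero x).hasFDerivAt)
    push_cast at hf ⊢
    rw [contDiff_succ_iff_hasFDerivAt]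
    refine ⟨fun w => applyBilin K E F (f'.comp w), ?_, hd⟩
    exact (applyBilin K E F).contDiff.comp (ih f' (contDiff_succ_iff_fderiv.1 hf).2.2)

theorem contDiff_comp_left {E : Type u} [NormedAddCommGroup E] [NormedSpace ℝ E]
    {F : Type (max u v)} [NormedAddCommGroup F] [NormedSpace ℝ F] (f : C(E, F))
    (hf : ContDiff ℝ ∞ f) : ContDiff ℝ ∞ (fun w : C(K, E) => f.comp w) :=
  contDiff_infty.2 fun n => contDiff_comp_left_nat.{u, v} n f (contDiff_infty.1 hf n)

end ContinuousMap

/-! ### Smooth dependence of ODE solutions on initial value and parameter -/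

/-- The primitive vanishing at `0` of a continuous function on `[-2, 2]`. -/
def primitiveCLM (E : Type*) [NormedAddCommGroup E] [NormedSpace ℝ E] :
    C(Icc (-2 : ℝ) 2, E) →L[ℝ] C(Icc (-2 : ℝ) 2, E) :=
  LinearMap.mkContinuous
    { toFun := fun w => ⟨fun t => ∫ r in (0 : ℝ)..t, w (projIcc (-2) 2 (by norm_num) r), by
        have : Continuous fun r => w (projIcc (-2 : ℝ) 2 (by norm_num) r) :=
          w.continuous.comp continuous_projIcc
        exact (intervalIntegral.continuous_primitive
          (fun a b => this.intervalIntegrable a b) 0).comp continuous_subtype_val⟩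
      map_add' := fun w w' => by
        ext t
        exact intervalIntegral.integral_add
          ((w.continuous.comp continuous_projIcc).intervalIntegrable _ _)
          ((w'.continuous.comp continuous_projIcc).intervalIntegrable _ _)
      map_smul' := fun c w => by
        ext t
        exact intervalIntegral.integral_smul c _ } 2
    fun w => by
      rw [ContinuousMap.norm_le _ (by positivity)]
      intro t
      have h := intervalIntegral.norm_integral_le_of_norm_le_const (a := (0 : ℝ)) (b := t)
        (f := fun r => w (projIcc (-2 : ℝ) 2 (by norm_num) r)) (C := ‖w‖)
        (fun r _ => w.norm_coe_le_norm _)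
      have ht : |(t : ℝ) - 0| ≤ 2 := by
        rw [sub_zero, abs_le]; exact t.2
      refine h.trans ?_
      rw [mul_comm]
      exact mul_le_mul_of_nonneg_right ht (norm_nonneg _)

/-- Solutions of `u' = X(u) ξ`, `u(0) = x`, on `[-2, 2]` in integral form depend smoothly on
`(x, ξ)` near `(x₀, 0)`. -/
theorem exists_contDiffAt_integral_solution {E : Type u} [NormedAddCommGroup E] [NormedSpace ℝ E]
    [CompleteSpace E] {F : Type v} [NormedAddCommGroup F] [NormedSpace ℝ F] [CompleteSpace F]
    (X : E → F →L[ℝ] E) (hX : ContDiff ℝ ∞ X) (x₀ : E) :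
    ∃ w : E × F → C(Icc (-2 : ℝ) 2, E), ContDiffAt ℝ ∞ w (x₀, 0) ∧
      w (x₀, 0) = ContinuousMap.const _ x₀ ∧
      ∀ᶠ q in 𝓝 (x₀, (0 : F)), ∀ t : Icc (-2 : ℝ) 2,
        w q t = q.1 + ∫ r in (0 : ℝ)..t, X (w q (projIcc (-2) 2 (by norm_num) r)) q.2 := by
  let K := Icc (-2 : ℝ) 2
  let XC : C(E, F →L[ℝ] E) := ⟨X, hX.continuous⟩
  let N : C(K, E) → C(K, F →L[ℝ] E) := fun w => XC.comp w
  have hN : ContDiff ℝ ∞ N := ContinuousMap.contDiff_comp_left.{u, v} (K := K) XC hX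
  let B := ContinuousMap.applyBilin K F E
  let cE := ContinuousMap.constCLM K E
  let cF := ContinuousMap.constCLM K F
  let J := primitiveCLM E
  have hB : ContDiff ℝ ∞ B := ContinuousLinearMap.contDiff _
  have hBN : ContDiff ℝ ∞ (fun z : (E × F) × C(K, E) => B (N z.2)) :=
    hB.comp (hN.comp contDiff_snd)
  let R : (E × F) × C(K, E) → C(K, E) := fun z => cE z.1.1 + J (B (N z.2) (cF z.1.2))
  have hR : ContDiff ℝ ∞ R := by
    have h1 : ContDiff ℝ ∞ (fun z : (E × F) × C(K, E) => cF z.1.2) :=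
      cF.contDiff.comp (contDiff_snd.comp contDiff_fst)
    have h2 : ContDiff ℝ ∞ (fun z : (E × F) × C(K, E) => cE z.1.1) :=
      cE.contDiff.comp (contDiff_fst.comp contDiff_fst)
    exact h2.add (J.contDiff.comp (hBN.clm_apply h1))
  -- Solutions are the fixed points of `R`, that is, the points where the second component of `G`
  -- vanishes. Keeping `z.1` as first component makes a local inverse of `G` an implicit function of
  -- the parameters.
  let G : (E × F) × C(K, E) → (E × F) × C(K, E) := fun z => (z.1, z.2 - R z)
  have hG : ContDiff ℝ ∞ G := contDiff_fst.prodMk (contDiff_snd.sub hR)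
  let z₀ : (E × F) × C(K, E) := ((x₀, 0), cE x₀)
  let S : E × F →L[ℝ] C(K, E) :=
    cE.comp (ContinuousLinearMap.fst ℝ E F) +
      (J.comp ((B (N (cE x₀))).comp cF)).comp (ContinuousLinearMap.snd ℝ E F)
  -- At `z₀` the parameter `ξ` is `0`, so `R` has no derivative in the direction of the curve. Hence
  -- the derivative of `G` is a shear, which is invertible without any smallness of the time
  -- interval.
  have hRd : HasFDerivAt R (S.comp (ContinuousLinearMap.fst ℝ (E × F) C(K, E))) z₀ := by
    have h1 : HasFDerivAt (fun z : (E × F) × C(K, E) => B (N z.2))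
        (fderiv ℝ (fun z : (E × F) × C(K, E) => B (N z.2)) z₀) z₀ :=
      (hBN.differentiable (by simp) z₀).hasFDerivAt
    have h2 : HasFDerivAt (fun z : (E × F) × C(K, E) => cF z.1.2)
        (cF.comp ((ContinuousLinearMap.snd ℝ E F).comp
          (ContinuousLinearMap.fst ℝ (E × F) C(K, E)))) z₀ :=
      (cF.comp ((ContinuousLinearMap.snd ℝ E F).comp
          (ContinuousLinearMap.fst ℝ (E × F) C(K, E)))).hasFDerivAt
    have h3 := (cE.comp ((ContinuousLinearMap.fst ℝ E F).comp
          (ContinuousLinearMap.fst ℝ (E × F) C(K, E)))).hasFDerivAt (x := z₀)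
    have h4 := h3.add ((J.hasFDerivAt).comp z₀ (h1.clm_apply h2))
    refine h4.congr_fderiv ?_
    ext z t <;> simp [S, z₀]
  let D : ((E × F) × C(K, E)) ≃L[ℝ] ((E × F) × C(K, E)) :=
    (ContinuousLinearEquiv.refl ℝ (E × F)).skewProd (ContinuousLinearEquiv.refl ℝ C(K, E)) (-S)
  have hGd : HasFDerivAt G (D : ((E × F) × C(K, E)) →L[ℝ] ((E × F) × C(K, E))) z₀ := by
    refine (hasFDerivAt_fst.prodMk (hasFDerivAt_snd.sub hRd)).congr_fderiv ?_
    ext z t <;> simp [D]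
  have hn : (∞ : WithTop ℕ∞) ≠ 0 := by simp
  have hGz : G z₀ = ((x₀, 0), 0) := by
    have : R z₀ = cE x₀ := by simp [R, z₀]
    simp only [G, this]
    simp [z₀]
  have hGs := hG.contDiffAt.hasStrictFDerivAt' (x := z₀) hGd hn
  have hinv := hG.contDiffAt.to_localInverse (a := z₀) hGd hn
  have hinv0 := hG.contDiffAt.localInverse_apply_image (a := z₀) hGd hn
  have hright : ∀ᶠ y in 𝓝 (G z₀), G (hG.contDiffAt.localInverse hGd hn y) = y :=
    hGs.eventually_right_inverse
  rw [hGz] at hinv hinv0 hright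
  set g := hG.contDiffAt.localInverse (a := z₀) hGd hn
  refine ⟨fun q => (g (q, 0)).2, ?_, ?_, ?_⟩
  · exact contDiffAt_snd.comp _ (hinv.comp (x₀, (0 : F)) (contDiffAt_id.prodMk contDiffAt_const))
  · change (g ((x₀, 0), 0)).2 = _
    rw [hinv0]; rfl
  · have hc : Tendsto (fun q : E × F => (q, (0 : C(K, E)))) (𝓝 (x₀, 0)) (𝓝 ((x₀, 0), 0)) :=
      (Continuous.prodMk continuous_id continuous_const).tendsto' _ _ rfl
    filter_upwards [hc.eventually hright] with q hq t
    have hq1 : (g (q, 0)).1 = q := congrArg Prod.fst hq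
    have hq2 : (g (q, 0)).2 - R (g (q, 0)) = 0 := congrArg Prod.snd hq
    have := congrArg (fun w : C(K, E) => w t) (sub_eq_zero.1 hq2)
    simp only [R, hq1] at this
    exact this

/-- Local flows of a smooth family of vector fields `X(·) ξ`, linear in `ξ`, for `ξ` near `0`. -/
theorem exists_contDiffAt_flow {E : Type u} [NormedAddCommGroup E] [NormedSpace ℝ E]
    [FiniteDimensional ℝ E] {F : Type v} [NormedAddCommGroup F] [NormedSpace ℝ F] [CompleteSpace F]
    (X : E → F →L[ℝ] E) {x₀ : E} {U : Set E} (hU : U ∈ 𝓝 x₀) (hX : ContDiffOn ℝ ∞ X U) :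
    ∃ φ : E × F → ℝ → E, ContDiffAt ℝ ∞ (fun q => φ q 1) (x₀, 0) ∧
      ∀ V ∈ 𝓝 x₀, ∀ᶠ q in 𝓝 (x₀, (0 : F)), φ q 0 = q.1 ∧
        ∀ t ∈ Ioo (-2 : ℝ) 2, φ q t ∈ V ∧ HasDerivAt (φ q) (X (φ q t) q.2) t := by
  have : CompleteSpace E := FiniteDimensional.complete ℝ E
  obtain ⟨r, hr, hrU⟩ := Metric.mem_nhds_iff.1 hU
  -- The cutoff makes the field globally smooth; it equals `1` on the ball of radius `r / 4`, where
  -- the field is unchanged.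
  let χ : ContDiffBump x₀ := ⟨r / 4, r / 2, by positivity, by linarith⟩
  have hsupp : tsupport χ ⊆ Metric.ball x₀ r := by
    rw [χ.tsupport_eq]
    exact Metric.closedBall_subset_ball (by change r / 2 < r; linarith)
  let Y : E → F →L[ℝ] E := fun x => χ x • X x
  have hY : ContDiff ℝ ∞ Y := by
    rw [contDiff_iff_contDiffAt]
    intro x
    by_cases hx : x ∈ Metric.ball x₀ r
    · exact χ.contDiff.contDiffAt.smul
        (hX.contDiffAt (Filter.mem_of_superset (Metric.isOpen_ball.mem_nhds hx) hrU))
    · have : Y =ᶠ[𝓝 x] fun _ => 0 := by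
        have hx' : (tsupport χ)ᶜ ∈ 𝓝 x :=
          (isClosed_tsupport _).isOpen_compl.mem_nhds fun h => hx (hsupp h)
        filter_upwards [hx'] with y hy
        simp [Y, image_eq_zero_of_notMem_tsupport hy]
      exact contDiffAt_const.congr_of_eventuallyEq this
  obtain ⟨w, hw, hw0, hsol⟩ := exists_contDiffAt_integral_solution Y hY x₀
  have h2 : (-2 : ℝ) ≤ 2 := by norm_num
  refine ⟨fun q t => w q (projIcc (-2) 2 h2 t), ?_, ?_⟩
  · let ev : C(Icc (-2 : ℝ) 2, E) →L[ℝ] E :=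
      ContinuousMap.evalCLM ℝ (projIcc (-2 : ℝ) 2 h2 1)
    exact ev.contDiff.contDiffAt.comp _ hw
  · intro V hV
    -- A solution uniformly `ε`-close to the constant curve `x₀` stays in `V` and in the region
    -- where `Y = X`.
    obtain ⟨ε, hε, hεV⟩ := Metric.mem_nhds_iff.1
      (Filter.inter_mem hV (Metric.ball_mem_nhds x₀ (show 0 < r / 4 by positivity)))
    have hclose : ∀ᶠ q in 𝓝 (x₀, (0 : F)), w q ∈ Metric.ball (ContinuousMap.const _ x₀) ε :=
      hw.continuousAt.eventually_mem (hw0 ▸ Metric.ball_mem_nhds _ hε)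
    filter_upwards [hclose, hsol] with q hq hsq
    refine ⟨?_, fun t ht => ?_⟩
    · have := hsq (projIcc (-2) 2 h2 0)
      rw [projIcc_of_mem h2 (show (0 : ℝ) ∈ Icc (-2 : ℝ) 2 by norm_num)] at this ⊢
      simpa using this
    · have hmem : ∀ t : ℝ, w q (projIcc (-2) 2 h2 t) ∈ V ∩ Metric.ball x₀ (r / 4) := fun t =>
        hεV (lt_of_le_of_lt ((w q).dist_apply_le_dist (g := ContinuousMap.const _ x₀) _) hq)
      refine ⟨(hmem t).1, ?_⟩
      have hXY : X (w q (projIcc (-2) 2 h2 t)) = Y (w q (projIcc (-2) 2 h2 t)) := by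
        have := χ.one_of_mem_closedBall (Metric.ball_subset_closedBall (hmem t).2)
        simp [Y, this]
      have hcont : Continuous fun r => Y (w q (projIcc (-2) 2 h2 r)) q.2 :=
        (hY.continuous.comp ((w q).continuous.comp continuous_projIcc)).clm_apply continuous_const
      have hd := (intervalIntegral.integral_hasDerivAt_right
        (hcont.intervalIntegrable 0 t) hcont.stronglyMeasurable.stronglyMeasurableAtFilter
        hcont.continuousAt).const_add q.1
      simp only [hXY]
      refine hd.congr_of_eventuallyEq ?_
      filter_upwards [Ioo_mem_nhds ht.1 ht.2] with t' ht'
      rw [hsq, projIcc_of_mem h2 (Ioo_subset_Icc_self ht')]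

/-! ### Iterated partial derivatives -/

lemma two_le_contDiff_infty : (2 : WithTop ℕ∞) ≤ ∞ :=
  WithTop.coe_le_coe.2 (le_top (a := ((2 : ℕ) : ℕ∞)))

section IteratedDeriv

variable {Y W : Type*} [NormedAddCommGroup Y] [NormedSpace ℝ Y]
  [NormedAddCommGroup W] [NormedSpace ℝ W]

/-- `ContDiffAt ℝ ∞` at a point provides, for each finite order, a neighbourhood that depends on the
order. Order two is enough for the derivatives taken at nearby points. -/
lemma ContDiffAt.eventually_two {f : Y → W} {y : Y} (hf : ContDiffAt ℝ ∞ f y) :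
    ∀ᶠ z in 𝓝 y, ContDiffAt ℝ 2 f z :=
  (hf.of_le two_le_contDiff_infty).eventually (by simp)

lemma ContDiffAt.eventually_hasDerivAt_right {G : Y × ℝ → W} {y₀ : Y} {b : ℝ}
    (hG : ContDiffAt ℝ ∞ G (y₀, b)) :
    ∀ᶠ y in 𝓝 y₀, HasDerivAt (fun t => G (y, t)) (fderiv ℝ G (y, b) (0, 1)) b := by
  have hc : Tendsto (fun y : Y => (y, b)) (𝓝 y₀) (𝓝 (y₀, b)) :=
    (Continuous.prodMk continuous_id continuous_const).tendsto' _ _ rfl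
  filter_upwards [hc.eventually hG.eventually_two] with y hy
  exact (hy.differentiableAt (by simp)).hasFDerivAt.comp_hasDerivAt (f := fun t => (y, t)) b
    ((hasDerivAt_const b y).prodMk (hasDerivAt_id b))

lemma ContDiffAt.deriv_right {G : Y × ℝ → W} {y₀ : Y} {b : ℝ}
    (hG : ContDiffAt ℝ ∞ G (y₀, b)) :
    ContDiffAt ℝ ∞ (fun y => deriv (fun t => G (y, t)) b) y₀ := by
  have h : ContDiffAt ℝ ∞ (fun y => fderiv ℝ G (y, b) (0, 1)) y₀ :=
    ((hG.fderiv_right (m := ∞) (by simp)).comp y₀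
      (contDiffAt_id.prodMk contDiffAt_const)).clm_apply contDiffAt_const
  refine h.congr_of_eventuallyEq ?_
  filter_upwards [hG.eventually_hasDerivAt_right] with y hy using hy.deriv

lemma eventually_deriv_right_sub {G H : Y × ℝ → W} {y₀ : Y} {b : ℝ}
    (hG : ContDiffAt ℝ ∞ G (y₀, b)) (hH : ContDiffAt ℝ ∞ H (y₀, b)) :
    ∀ᶠ y in 𝓝 y₀, deriv (fun t => G (y, t) - H (y, t)) b =
      deriv (fun t => G (y, t)) b - deriv (fun t => H (y, t)) b := by
  filter_upwards [hG.eventually_hasDerivAt_right, hH.eventually_hasDerivAt_right] with y h1 h2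
  exact deriv_fun_sub h1.differentiableAt h2.differentiableAt

lemma HasFDerivAt.hasDerivAt_comp_curve {f : Y → W} {f' : Y →L[ℝ] W} {c : ℝ → Y} {c' : Y}
    {t : ℝ} (hf : HasFDerivAt f f' (c t)) (hc : HasDerivAt c c' t) :
    HasDerivAt (fun r => f (c r)) (f' c') t :=
  hf.comp_hasDerivAt t hc

/-- Iterated partial derivatives commute. -/
lemma deriv_deriv_comm {f : ℝ × ℝ → W} {a b : ℝ} (hf : ContDiffAt ℝ 2 f (a, b)) :
    deriv (fun s => deriv (fun t => f (s, t)) b) a =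
      deriv (fun t => deriv (fun s => f (s, t)) a) b := by
  have hd : ∀ᶠ z in 𝓝 (a, b), DifferentiableAt ℝ f z :=
    (hf.eventually (by simp)).mono fun z hz => hz.differentiableAt (by simp)
  have hf' : DifferentiableAt ℝ (fderiv ℝ f) (a, b) :=
    (hf.fderiv_right (m := 1) (by norm_num)).differentiableAt (by simp)
  have e1 : (fun s => deriv (fun t => f (s, t)) b) =ᶠ[𝓝 a] fun s => fderiv ℝ f (s, b) (0, 1) := by
    have hc : Tendsto (fun s : ℝ => (s, b)) (𝓝 a) (𝓝 (a, b)) :=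
      (Continuous.prodMk continuous_id continuous_const).tendsto' _ _ rfl
    filter_upwards [hc.eventually hd] with s hs
    exact (hs.hasFDerivAt.comp_hasDerivAt (f := fun t => (s, t)) b
      ((hasDerivAt_const b s).prodMk (hasDerivAt_id b))).deriv
  have e2 : (fun t => deriv (fun s => f (s, t)) a) =ᶠ[𝓝 b] fun t => fderiv ℝ f (a, t) (1, 0) := by
    have hc : Tendsto (fun t : ℝ => (a, t)) (𝓝 b) (𝓝 (a, b)) :=
      (Continuous.prodMk continuous_const continuous_id).tendsto' _ _ rfl
    filter_upwards [hc.eventually hd] with t ht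
    exact (ht.hasFDerivAt.comp_hasDerivAt (f := fun s => (s, t)) a
      ((hasDerivAt_id a).prodMk (hasDerivAt_const a t))).deriv
  have d1 : HasDerivAt (fun s => fderiv ℝ f (s, b)) (fderiv ℝ (fderiv ℝ f) (a, b) (1, 0)) a :=
    hf'.hasFDerivAt.comp_hasDerivAt (f := fun s => (s, b)) a
      ((hasDerivAt_id a).prodMk (hasDerivAt_const a b))
  have d2 : HasDerivAt (fun t => fderiv ℝ f (a, t)) (fderiv ℝ (fderiv ℝ f) (a, b) (0, 1)) b :=
    hf'.hasFDerivAt.comp_hasDerivAt (f := fun t => (a, t)) b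
      ((hasDerivAt_const b a).prodMk (hasDerivAt_id b))
  rw [e1.deriv_eq, e2.deriv_eq]
  have d1' := (d1.clm_apply (hasDerivAt_const a ((0, 1) : ℝ × ℝ))).deriv
  have d2' := (d2.clm_apply (hasDerivAt_const b ((1, 0) : ℝ × ℝ))).deriv
  simp only [map_zero, add_zero] at d1' d2'
  rw [d1', d2']
  exact hf.isSymmSndFDerivAt (by simp) _ _

/-- Reversal of the order of three partial derivatives. -/
lemma deriv_deriv_deriv_reverse {G : ℝ × ℝ × ℝ → W} (hG : ContDiffAt ℝ ∞ G (0, 0, 0)) :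
    deriv (fun a => deriv (fun b => deriv (fun c => G (a, b, c)) 0) 0) 0 =
      deriv (fun c => deriv (fun b => deriv (fun a => G (a, b, c)) 0) 0) 0 := by
  -- The reversal is a product of three transpositions: the inner two derivatives, the outer two,
  -- then the inner two again.
  have e1 : (fun a => deriv (fun b => deriv (fun c => G (a, b, c)) 0) 0) =ᶠ[𝓝 0]
      fun a => deriv (fun c => deriv (fun b => G (a, b, c)) 0) 0 := by
    have hc : Tendsto (fun a : ℝ => (a, (0 : ℝ), (0 : ℝ))) (𝓝 0) (𝓝 (0, 0, 0)) :=
      Continuous.tendsto' (by fun_prop) _ _ rfl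
    filter_upwards [hc.eventually hG.eventually_two] with a ha
    exact deriv_deriv_comm (f := fun z => G (a, z.1, z.2))
      (ContDiffAt.comp (g := G) (f := fun z : ℝ × ℝ => (a, z.1, z.2)) (0, 0) ha (by fun_prop))
  have e3 : (fun c => deriv (fun a => deriv (fun b => G (a, b, c)) 0) 0) =ᶠ[𝓝 0]
      fun c => deriv (fun b => deriv (fun a => G (a, b, c)) 0) 0 := by
    have hc : Tendsto (fun c : ℝ => ((0 : ℝ), (0 : ℝ), c)) (𝓝 0) (𝓝 (0, 0, 0)) :=
      Continuous.tendsto' (by fun_prop) _ _ rfl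
    filter_upwards [hc.eventually hG.eventually_two] with c hc
    exact deriv_deriv_comm (f := fun z => G (z.1, z.2, c))
      (ContDiffAt.comp (g := G) (f := fun z : ℝ × ℝ => (z.1, z.2, c)) (0, 0) hc (by fun_prop))
  have h2 : ContDiffAt ℝ ∞ (fun z : ℝ × ℝ => deriv (fun b => G (z.1, b, z.2)) 0) (0, 0) :=
    ContDiffAt.deriv_right (G := fun w : (ℝ × ℝ) × ℝ => G (w.1.1, w.2, w.1.2))
      (ContDiffAt.comp (g := G) (f := fun w : (ℝ × ℝ) × ℝ => (w.1.1, w.2, w.1.2)) ((0, 0), 0) hG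
        (by fun_prop))
  rw [e1.deriv_eq, deriv_deriv_comm (f := fun z : ℝ × ℝ => deriv (fun b => G (z.1, b, z.2)) 0)
    (h2.of_le two_le_contDiff_infty), e3.deriv_eq]

end IteratedDeriv

/-! ### Infinitesimal calculus of local products with unit -/

/-- A smooth local product near `0` with two-sided unit `0`. -/
structure IsLocalUnitalProduct {V : Type*} [NormedAddCommGroup V] [NormedSpace ℝ V]
    (m : V × V → V) : Prop where
  contDiffAt : ContDiffAt ℝ ∞ m (0, 0)
  mul_zero : ∀ᶠ x in 𝓝 0, m (x, 0) = x
  zero_mul : ∀ᶠ y in 𝓝 0, m (0, y) = y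

namespace IsLocalUnitalProduct

variable {V : Type*} [NormedAddCommGroup V] [NormedSpace ℝ V]

/-- The derivative of a product in the left factor at `0`. -/
def leftDeriv (m : V × V → V) (y : V) : V →L[ℝ] V :=
  (fderiv ℝ m (0, y)).comp (ContinuousLinearMap.inl ℝ V V)

/-- The derivative of a product in the right factor at `0`. -/
def rightDeriv (m : V × V → V) (x : V) : V →L[ℝ] V :=
  (fderiv ℝ m (x, 0)).comp (ContinuousLinearMap.inr ℝ V V)

variable {m : V × V → V}

lemma contDiffAt_leftDeriv (hm : IsLocalUnitalProduct m) : ContDiffAt ℝ ∞ (leftDeriv m) 0 :=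
  (ContDiffAt.comp (f := fun y : V => ((0 : V), y)) (0 : V)
    (hm.contDiffAt.fderiv_right (m := ∞) (by simp)) (by fun_prop)).clm_comp contDiffAt_const

lemma contDiffAt_rightDeriv (hm : IsLocalUnitalProduct m) : ContDiffAt ℝ ∞ (rightDeriv m) 0 :=
  (ContDiffAt.comp (f := fun y : V => (y, (0 : V))) (0 : V)
    (hm.contDiffAt.fderiv_right (m := ∞) (by simp)) (by fun_prop)).clm_comp contDiffAt_const

lemma eventually_hasDerivAt_left (hm : IsLocalUnitalProduct m) :
    ∀ᶠ y in 𝓝 0, ∀ ξ, HasDerivAt (fun t : ℝ => m (t • ξ, y)) (leftDeriv m y ξ) 0 := by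
  have hc : Tendsto (fun y : V => ((0 : V), y)) (𝓝 0) (𝓝 (0, 0)) :=
    Continuous.tendsto' (by fun_prop) _ _ rfl
  filter_upwards [hc.eventually hm.contDiffAt.eventually_two] with y hy ξ
  have hd := (hy.differentiableAt (by simp)).hasFDerivAt
  have hl : HasDerivAt (fun t : ℝ => (t • ξ, y)) (ξ, 0) 0 := by
    simpa using ((hasDerivAt_id (0 : ℝ)).smul_const ξ).prodMk (hasDerivAt_const (0 : ℝ) y)
  have hd' : HasFDerivAt m (fderiv ℝ m (0, y)) ((0 : ℝ) • ξ, y) := by rwa [zero_smul]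
  exact hd'.comp_hasDerivAt (0 : ℝ) hl

lemma eventually_hasDerivAt_right (hm : IsLocalUnitalProduct m) :
    ∀ᶠ x in 𝓝 0, ∀ η, HasDerivAt (fun t : ℝ => m (x, t • η)) (rightDeriv m x η) 0 := by
  have hc : Tendsto (fun y : V => (y, (0 : V))) (𝓝 0) (𝓝 (0, 0)) :=
    Continuous.tendsto' (by fun_prop) _ _ rfl
  filter_upwards [hc.eventually hm.contDiffAt.eventually_two] with x hx ξ
  have hd := (hx.differentiableAt (by simp)).hasFDerivAt
  have hl : HasDerivAt (fun t : ℝ => (x, t • ξ)) (0, ξ) 0 := by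
    simpa using (hasDerivAt_const (0 : ℝ) x).prodMk ((hasDerivAt_id (0 : ℝ)).smul_const ξ)
  have hd' : HasFDerivAt m (fderiv ℝ m (x, 0)) (x, (0 : ℝ) • ξ) := by rwa [zero_smul]
  exact hd'.comp_hasDerivAt (0 : ℝ) hl

lemma tendsto_smul_zero (ξ : V) : Tendsto (fun t : ℝ => t • ξ) (𝓝 0) (𝓝 0) :=
  Continuous.tendsto' (by fun_prop) _ _ (zero_smul ℝ ξ)

lemma hasDerivAt_smul_zero (ξ : V) : HasDerivAt (fun t : ℝ => t • ξ) ξ 0 := by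
  simpa using (hasDerivAt_id (0 : ℝ)).smul_const ξ

lemma leftDeriv_zero (hm : IsLocalUnitalProduct m) : leftDeriv m 0 = ContinuousLinearMap.id ℝ V := by
  ext ξ
  refine (hm.eventually_hasDerivAt_left.self_of_nhds ξ).unique ?_
  refine (hasDerivAt_smul_zero ξ).congr_of_eventuallyEq ?_
  filter_upwards [(tendsto_smul_zero ξ).eventually hm.mul_zero] with t ht using ht

lemma rightDeriv_zero (hm : IsLocalUnitalProduct m) :
    rightDeriv m 0 = ContinuousLinearMap.id ℝ V := by
  ext ξ
  refine (hm.eventually_hasDerivAt_right.self_of_nhds ξ).unique ?_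
  refine (hasDerivAt_smul_zero ξ).congr_of_eventuallyEq ?_
  filter_upwards [(tendsto_smul_zero ξ).eventually hm.zero_mul] with t ht using ht

/-- Both sides are the mixed second derivative of `m` at `(0, 0)`, with the order of differentiation
exchanged. -/
lemma fderiv_rightDeriv_swap (hm : IsLocalUnitalProduct m) (ξ η : V) :
    fderiv ℝ (rightDeriv m) 0 ξ η = fderiv ℝ (leftDeriv m) 0 η ξ := by
  have hf' : DifferentiableAt ℝ (fderiv ℝ m) (0, 0) :=
    (hm.contDiffAt.fderiv_right (m := ∞) (by simp)).differentiableAt (by simp)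
  have hR : HasFDerivAt (fun x : V => fderiv ℝ m (x, 0))
      ((fderiv ℝ (fderiv ℝ m) (0, 0)).comp (ContinuousLinearMap.inl ℝ V V)) 0 :=
    HasFDerivAt.comp (g := fderiv ℝ m) (0 : V) hf'.hasFDerivAt (hasFDerivAt_prodMk_left 0 0)
  have hL : HasFDerivAt (fun x : V => fderiv ℝ m (0, x))
      ((fderiv ℝ (fderiv ℝ m) (0, 0)).comp (ContinuousLinearMap.inr ℝ V V)) 0 :=
    HasFDerivAt.comp (g := fderiv ℝ m) (0 : V) hf'.hasFDerivAt (hasFDerivAt_prodMk_right 0 0)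
  have h1 := (hR.clm_comp (hasFDerivAt_const (ContinuousLinearMap.inr ℝ V V) (0 : V))).fderiv
  have h2 := (hL.clm_comp (hasFDerivAt_const (ContinuousLinearMap.inl ℝ V V) (0 : V))).fderiv
  have h1' : fderiv ℝ (rightDeriv m) 0 = _ := h1
  have h2' : fderiv ℝ (leftDeriv m) 0 = _ := h2
  rw [h1', h2']
  simpa using hm.contDiffAt.isSymmSndFDerivAt (by simpa using two_le_contDiff_infty) (ξ, 0) (0, η)

variable {W : Type*} [NormedAddCommGroup W] [NormedSpace ℝ W]

/-- The mixed second derivative of a function of a product. -/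
lemma deriv_deriv_comp (hm : IsLocalUnitalProduct m) {h : V → W} (hh : ContDiffAt ℝ ∞ h 0)
    (ξ η : V) :
    deriv (fun t₁ : ℝ => deriv (fun t₂ : ℝ => h (m (t₁ • ξ, t₂ • η))) 0) 0 =
      fderiv ℝ (fderiv ℝ h) 0 ξ η + fderiv ℝ h 0 (fderiv ℝ (rightDeriv m) 0 ξ η) := by
  have e : (fun t₁ : ℝ => deriv (fun t₂ : ℝ => h (m (t₁ • ξ, t₂ • η))) 0) =ᶠ[𝓝 0]
      fun t₁ => fderiv ℝ h (t₁ • ξ) (rightDeriv m (t₁ • ξ) η) := by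
    filter_upwards [(tendsto_smul_zero ξ).eventually hm.mul_zero,
      (tendsto_smul_zero ξ).eventually hm.eventually_hasDerivAt_right,
      (tendsto_smul_zero ξ).eventually hh.eventually_two] with t h1 h2 h3
    have hd := (h3.differentiableAt (by simp)).hasFDerivAt
    have hz : t • ξ = m (t • ξ, (0 : ℝ) • η) := by rw [zero_smul, h1]
    have hd' : HasFDerivAt h (fderiv ℝ h (t • ξ)) (m (t • ξ, (0 : ℝ) • η)) := hz ▸ hd
    exact (hd'.comp_hasDerivAt (0 : ℝ) (h2 η)).deriv
  rw [e.deriv_eq]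
  have hh' : HasFDerivAt (fderiv ℝ h) (fderiv ℝ (fderiv ℝ h) 0) ((0 : ℝ) • ξ) := by
    rw [zero_smul]
    exact ((hh.fderiv_right (m := ∞) (by simp)).differentiableAt (by simp)).hasFDerivAt
  have hT : HasFDerivAt (rightDeriv m) (fderiv ℝ (rightDeriv m) 0) ((0 : ℝ) • ξ) := by
    rw [zero_smul]
    exact (hm.contDiffAt_rightDeriv.differentiableAt (by simp)).hasFDerivAt
  have d1 := hh'.comp_hasDerivAt (0 : ℝ) (hasDerivAt_smul_zero ξ)
  have d2 := hT.comp_hasDerivAt (0 : ℝ) (hasDerivAt_smul_zero ξ)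
  have d3 := (d1.clm_apply (d2.clm_apply (hasDerivAt_const (0 : ℝ) η))).deriv
  simp only [Function.comp_def, zero_smul, map_zero, add_zero, hm.rightDeriv_zero,
    ContinuousLinearMap.id_apply] at d3
  exact d3

lemma contDiffAt_smul_smul (hm : IsLocalUnitalProduct m) (ξ η : V) :
    ContDiffAt ℝ ∞ (fun z : ℝ × ℝ => m (z.1 • ξ, z.2 • η)) (0, 0) := by
  refine ContDiffAt.comp (g := m) (f := fun z : ℝ × ℝ => (z.1 • ξ, z.2 • η)) (0, 0) ?_ (by fun_prop)
  simpa using hm.contDiffAt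

/-- The antisymmetrized mixed second derivative of the product. -/
theorem deriv_deriv_commutator (hm : IsLocalUnitalProduct m) (ξ η : V) :
    deriv (fun t₁ : ℝ => deriv (fun t₂ : ℝ =>
        m (t₁ • ξ, t₂ • η) - m (t₂ • η, t₁ • ξ)) 0) 0 =
      fderiv ℝ (leftDeriv m) 0 η ξ - fderiv ℝ (leftDeriv m) 0 ξ η := by
  have c1 := hm.contDiffAt_smul_smul ξ η
  have c2 : ContDiffAt ℝ ∞ (fun z : ℝ × ℝ => m (z.2 • η, z.1 • ξ)) (0, 0) :=
    ContDiffAt.comp (f := fun z : ℝ × ℝ => (z.2, z.1)) (0, 0) (hm.contDiffAt_smul_smul η ξ)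
      (by fun_prop)
  have e : (fun t₁ : ℝ => deriv (fun t₂ : ℝ => m (t₁ • ξ, t₂ • η) - m (t₂ • η, t₁ • ξ)) 0)
      =ᶠ[𝓝 0] _ := eventually_deriv_right_sub c1 c2
  rw [e.deriv_eq, deriv_fun_sub (c1.deriv_right.differentiableAt (by simp))
    (c2.deriv_right.differentiableAt (by simp)),
    deriv_deriv_comm (f := fun z : ℝ × ℝ => m (z.2 • η, z.1 • ξ))
      (c2.of_le two_le_contDiff_infty)]
  -- With `h = id` the second-order term vanishes and the mixed derivative of `m` itself remains.
  have f1 := hm.deriv_deriv_comp (h := id) contDiffAt_id ξ η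
  have f2 := hm.deriv_deriv_comp (h := id) contDiffAt_id η ξ
  have hid : fderiv ℝ (fderiv ℝ (id : V → V)) 0 = 0 := by
    have : fderiv ℝ (id : V → V) = fun _ => ContinuousLinearMap.id ℝ V := by ext; simp
    rw [this]; simp
  simp only [id, hid, fderiv_id, hm.fderiv_rightDeriv_swap] at f1 f2
  simp only [f1, f2]
  simp

/-- The third mixed derivative of the associator of a product. -/
def associatorDeriv (m : V × V → V) (ξ η γ : V) : V :=
  deriv (fun t₁ : ℝ => deriv (fun t₂ : ℝ => deriv (fun t₃ : ℝ =>
    m (t₁ • ξ, m (t₂ • η, t₃ • γ)) - m (m (t₁ • ξ, t₂ • η), t₃ • γ)) 0) 0) 0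

lemma contDiffAt_mul_assoc_right (hm : IsLocalUnitalProduct m) (ξ η γ : V) :
    ContDiffAt ℝ ∞ (fun z : ℝ × ℝ × ℝ => m (z.1 • ξ, m (z.2.1 • η, z.2.2 • γ))) (0, 0, 0) := by
  have h00 : m (0, 0) = 0 := hm.mul_zero.self_of_nhds
  refine ContDiffAt.comp (g := m)
    (f := fun z : ℝ × ℝ × ℝ => (z.1 • ξ, m (z.2.1 • η, z.2.2 • γ))) (0, 0, 0)
    (by simpa [h00] using hm.contDiffAt) (ContDiffAt.prodMk (by fun_prop) ?_)
  exact ContDiffAt.comp (g := fun z : ℝ × ℝ => m (z.1 • η, z.2 • γ)) (0, 0, 0)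
    (hm.contDiffAt_smul_smul η γ) contDiffAt_snd

lemma contDiffAt_mul_assoc_left (hm : IsLocalUnitalProduct m) (ξ η γ : V) :
    ContDiffAt ℝ ∞ (fun z : ℝ × ℝ × ℝ => m (m (z.1 • ξ, z.2.1 • η), z.2.2 • γ)) (0, 0, 0) := by
  have h00 : m (0, 0) = 0 := hm.mul_zero.self_of_nhds
  refine ContDiffAt.comp (g := m)
    (f := fun z : ℝ × ℝ × ℝ => (m (z.1 • ξ, z.2.1 • η), z.2.2 • γ)) (0, 0, 0)
    (by simpa [h00] using hm.contDiffAt) (ContDiffAt.prodMk ?_ (by fun_prop))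
  exact ContDiffAt.comp (g := fun z : ℝ × ℝ => m (z.1 • ξ, z.2 • η))
    (f := fun z : ℝ × ℝ × ℝ => (z.1, z.2.1)) (0, 0, 0)
    (hm.contDiffAt_smul_smul ξ η) (by fun_prop)

lemma associatorDeriv_eq_sub (hm : IsLocalUnitalProduct m) (ξ η γ : V) :
    associatorDeriv m ξ η γ =
      deriv (fun t₁ : ℝ => deriv (fun t₂ : ℝ => deriv (fun t₃ : ℝ =>
        m (t₁ • ξ, m (t₂ • η, t₃ • γ))) 0) 0) 0 -
      deriv (fun t₁ : ℝ => deriv (fun t₂ : ℝ => deriv (fun t₃ : ℝ =>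
        m (m (t₁ • ξ, t₂ • η), t₃ • γ)) 0) 0) 0 := by
  have s1 : ContDiffAt ℝ ∞ (fun z : (ℝ × ℝ) × ℝ => m (z.1.1 • ξ, m (z.1.2 • η, z.2 • γ)))
      ((0, 0), 0) :=
    ContDiffAt.comp (f := fun z : (ℝ × ℝ) × ℝ => (z.1.1, z.1.2, z.2)) ((0, 0), 0)
      (hm.contDiffAt_mul_assoc_right ξ η γ) (by fun_prop)
  have s2 : ContDiffAt ℝ ∞ (fun z : (ℝ × ℝ) × ℝ => m (m (z.1.1 • ξ, z.1.2 • η), z.2 • γ))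
      ((0, 0), 0) :=
    ContDiffAt.comp (f := fun z : (ℝ × ℝ) × ℝ => (z.1.1, z.1.2, z.2)) ((0, 0), 0)
      (hm.contDiffAt_mul_assoc_left ξ η γ) (by fun_prop)
  have ev3 := (eventually_deriv_right_sub s1 s2).curry_nhds
  have d1 : ContDiffAt ℝ ∞ (fun z : ℝ × ℝ =>
    deriv (fun t : ℝ => m (z.1 • ξ, m (z.2 • η, t • γ))) 0) (0, 0) := s1.deriv_right
  have d2 : ContDiffAt ℝ ∞ (fun z : ℝ × ℝ =>
    deriv (fun t : ℝ => m (m (z.1 • ξ, z.2 • η), t • γ)) 0) (0, 0) := s2.deriv_right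
  have ev2 := eventually_deriv_right_sub d1 d2
  rw [← deriv_fun_sub (d1.deriv_right.differentiableAt (by simp))
    (d2.deriv_right.differentiableAt (by simp))]
  refine Filter.EventuallyEq.deriv_eq ?_
  filter_upwards [ev3, ev2] with t h3 h2
  exact (Filter.EventuallyEq.deriv_eq h3).trans h2

/-- With the order reversed, differentiating in `t₁` gives `leftDeriv m` at `m (t₂ • η, t₃ • γ)`. As
`t₂` passes through `0` this point moves from `t₃ • γ` with velocity `leftDeriv m (t₃ • γ) η`, and
the chain rule applies. -/
lemma deriv_mul_assoc_right (hm : IsLocalUnitalProduct m) (ξ η γ : V) :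
    deriv (fun t₁ : ℝ => deriv (fun t₂ : ℝ => deriv (fun t₃ : ℝ =>
        m (t₁ • ξ, m (t₂ • η, t₃ • γ))) 0) 0) 0 =
      fderiv ℝ (fun y => fderiv ℝ (leftDeriv m) y (leftDeriv m y η) ξ) 0 γ := by
  have h00 : m (0, 0) = 0 := hm.mul_zero.self_of_nhds
  rw [deriv_deriv_deriv_reverse (hm.contDiffAt_mul_assoc_right ξ η γ)]
  have hA := hm.contDiffAt_leftDeriv
  have hA2 : ContDiffAt ℝ ∞ (fderiv ℝ (leftDeriv m)) 0 := hA.fderiv_right (m := ∞) (by simp)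
  have hC : ContDiffAt ℝ ∞ (fun y => fderiv ℝ (leftDeriv m) y (leftDeriv m y η) ξ) 0 :=
    (hA2.clm_apply (hA.clm_apply contDiffAt_const)).clm_apply contDiffAt_const
  have tm : Tendsto (fun z : ℝ × ℝ => m (z.2 • η, z.1 • γ)) (𝓝 (0, 0)) (𝓝 0) := by
    have : ContinuousAt (fun z : ℝ × ℝ => m (z.2 • η, z.1 • γ)) (0, 0) :=
      ContinuousAt.comp (f := fun z : ℝ × ℝ => (z.2, z.1)) (x := (0, 0))
        (hm.contDiffAt_smul_smul η γ).continuousAt (by fun_prop)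
    simpa [ContinuousAt, h00] using this
  have e1 : ∀ᶠ z in 𝓝 ((0 : ℝ), (0 : ℝ)),
      deriv (fun t : ℝ => m (t • ξ, m (z.2 • η, z.1 • γ))) 0 =
        leftDeriv m (m (z.2 • η, z.1 • γ)) ξ := by
    filter_upwards [tm.eventually hm.eventually_hasDerivAt_left] with z hz using (hz ξ).deriv
  have e2 : (fun c : ℝ => deriv (fun b : ℝ => deriv (fun a : ℝ =>
        m (a • ξ, m (b • η, c • γ))) 0) 0) =ᶠ[𝓝 0]
      fun c => fderiv ℝ (leftDeriv m) (c • γ) (leftDeriv m (c • γ) η) ξ := by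
    filter_upwards [e1.curry_nhds, (tendsto_smul_zero γ).eventually hm.zero_mul,
      (tendsto_smul_zero γ).eventually hm.eventually_hasDerivAt_left,
      (tendsto_smul_zero γ).eventually hA.eventually_two] with c h1 h2 h3 h4
    refine (Filter.EventuallyEq.deriv_eq h1).trans ?_
    have hd := (h4.differentiableAt (by simp)).hasFDerivAt
    have hz : c • γ = m ((0 : ℝ) • η, c • γ) := by rw [zero_smul, h2]
    have hd' : HasFDerivAt (leftDeriv m) (fderiv ℝ (leftDeriv m) (c • γ))
      (m ((0 : ℝ) • η, c • γ)) := hz ▸ hd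
    have h5 : HasDerivAt (fun b : ℝ => leftDeriv m (m (b • η, c • γ)))
        (fderiv ℝ (leftDeriv m) (c • γ) (leftDeriv m (c • γ) η)) 0 :=
      HasFDerivAt.hasDerivAt_comp_curve (c := fun b : ℝ => m (b • η, c • γ)) hd' (h3 η)
    exact (HasFDerivAt.hasDerivAt_comp_curve (ContinuousLinearMap.apply ℝ V ξ).hasFDerivAt h5).deriv
  refine e2.deriv_eq.trans ?_
  have hd := (hC.differentiableAt (by simp)).hasFDerivAt
  have hz : (fun t : ℝ => t • γ) 0 = 0 := zero_smul ℝ γ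
  rw [← hz] at hd
  rw [(HasFDerivAt.hasDerivAt_comp_curve (c := fun t : ℝ => t • γ) hd
    (hasDerivAt_smul_zero γ)).deriv, hz]

/-- Differentiating in `t₃` first gives `rightDeriv m` at `m (t₁ • ξ, t₂ • η)`, a function of a
product, to which `deriv_deriv_comp` applies. -/
lemma deriv_mul_assoc_left (hm : IsLocalUnitalProduct m) (ξ η γ : V) :
    deriv (fun t₁ : ℝ => deriv (fun t₂ : ℝ => deriv (fun t₃ : ℝ =>
        m (m (t₁ • ξ, t₂ • η), t₃ • γ)) 0) 0) 0 =
      fderiv ℝ (fderiv ℝ (fun w => rightDeriv m w γ)) 0 ξ η +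
        fderiv ℝ (fun w => rightDeriv m w γ) 0 (fderiv ℝ (rightDeriv m) 0 ξ η) := by
  have h00 : m (0, 0) = 0 := hm.mul_zero.self_of_nhds
  have tm : Tendsto (fun z : ℝ × ℝ => m (z.1 • ξ, z.2 • η)) (𝓝 (0, 0)) (𝓝 0) := by
    simpa [ContinuousAt, h00] using (hm.contDiffAt_smul_smul ξ η).continuousAt
  have e1 : ∀ᶠ z in 𝓝 ((0 : ℝ), (0 : ℝ)),
      deriv (fun t : ℝ => m (m (z.1 • ξ, z.2 • η), t • γ)) 0 =
        rightDeriv m (m (z.1 • ξ, z.2 • η)) γ := by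
    filter_upwards [tm.eventually hm.eventually_hasDerivAt_right] with z hz using (hz γ).deriv
  rw [← hm.deriv_deriv_comp (h := fun w => rightDeriv m w γ)
    (hm.contDiffAt_rightDeriv.clm_apply contDiffAt_const)]
  refine Filter.EventuallyEq.deriv_eq ?_
  filter_upwards [e1.curry_nhds] with t ht
  exact Filter.EventuallyEq.deriv_eq ht

lemma associatorDeriv_eq (hm : IsLocalUnitalProduct m) (ξ η γ : V) :
    associatorDeriv m ξ η γ =
      fderiv ℝ (fun y => fderiv ℝ (leftDeriv m) y (leftDeriv m y η) ξ) 0 γ -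
      (fderiv ℝ (fderiv ℝ (fun w => rightDeriv m w γ)) 0 ξ η +
        fderiv ℝ (fun w => rightDeriv m w γ) 0 (fderiv ℝ (rightDeriv m) 0 ξ η)) := by
  rw [hm.associatorDeriv_eq_sub, hm.deriv_mul_assoc_right, hm.deriv_mul_assoc_left]

/-- The skew-symmetrization of the third derivative of the associator is the derivative of the
structure function `β` of the frame given by the derivatives in the left factor. -/
theorem associatorDeriv_sub (hm : IsLocalUnitalProduct m) (ξ η γ : V) {β : V → V}
    (hβd : DifferentiableAt ℝ β 0)
    (hβ : ∀ᶠ y in 𝓝 0, leftDeriv m y (β y) =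
      fderiv ℝ (leftDeriv m) y (leftDeriv m y η) ξ - fderiv ℝ (leftDeriv m) y (leftDeriv m y ξ) η) :
    fderiv ℝ β 0 γ = associatorDeriv m ξ η γ - associatorDeriv m η ξ γ := by
  have hA := hm.contDiffAt_leftDeriv
  have hT := hm.contDiffAt_rightDeriv
  have hA2 : ContDiffAt ℝ ∞ (fderiv ℝ (leftDeriv m)) 0 := hA.fderiv_right (m := ∞) (by simp)
  have hC : ∀ ξ η : V, DifferentiableAt ℝ
      (fun y => fderiv ℝ (leftDeriv m) y (leftDeriv m y η) ξ) 0 := fun ξ η =>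
    ((hA2.clm_apply (hA.clm_apply contDiffAt_const)).clm_apply
      contDiffAt_const).differentiableAt (by simp)
  have hAd := (hA.differentiableAt (n := ∞) (by simp)).hasFDerivAt
  have hTd := (hT.differentiableAt (n := ∞) (by simp)).hasFDerivAt
  have h1 : fderiv ℝ (fun y => leftDeriv m y (β y)) 0 γ =
      fderiv ℝ β 0 γ + fderiv ℝ (leftDeriv m) 0 γ (β 0) := by
    rw [(hAd.clm_apply hβd.hasFDerivAt).fderiv]
    simp [hm.leftDeriv_zero]
  rw [Filter.EventuallyEq.fderiv_eq hβ, fderiv_fun_sub (hC ξ η) (hC η ξ)] at h1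
  have h2 := hβ.self_of_nhds
  simp only [hm.leftDeriv_zero, ContinuousLinearMap.id_apply] at h2
  have h3 : ∀ ζ, fderiv ℝ (fun w => rightDeriv m w γ) 0 ζ = fderiv ℝ (leftDeriv m) 0 γ ζ := by
    intro ζ
    rw [(hTd.clm_apply (hasFDerivAt_const γ (0 : V))).fderiv, ← hm.fderiv_rightDeriv_swap]
    simp
  -- This second-order term is symmetric in `ξ` and `η`, so it drops out of the skew-symmetrization.
  have h4 : fderiv ℝ (fderiv ℝ (fun w => rightDeriv m w γ)) 0 ξ η =
      fderiv ℝ (fderiv ℝ (fun w => rightDeriv m w γ)) 0 η ξ :=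
    (ContDiffAt.isSymmSndFDerivAt (n := ∞) (hT.clm_apply contDiffAt_const) (by simpa using two_le_contDiff_infty)) ξ η
  rw [hm.associatorDeriv_eq, hm.associatorDeriv_eq, h4, h3, h3, hm.fderiv_rightDeriv_swap,
    hm.fderiv_rightDeriv_swap]
  rw [h2, map_sub] at h1
  simp only [sub_apply] at h1
  rw [← sub_eq_iff_eq_add] at h1
  rw [← h1]
  abel

end IsLocalUnitalProduct

/-! ### Flows of fundamental fields and their smoothness near `ξ = 0` -/

namespace Parallelization

variable {E : Type*} [NormedAddCommGroup E] [NormedSpace ℝ E]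
  {L : Type*} [TopologicalSpace L] [ChartedSpace E L] [IsManifold 𝓘(ℝ, E) ∞ L]
  {𝔩 : Type*} [NormedAddCommGroup 𝔩] [NormedSpace ℝ 𝔩]
  (P : Parallelization E L 𝔩)

lemma contMDiff_fundamental (ξ : 𝔩) :
    ContMDiff 𝓘(ℝ, E) 𝓘(ℝ, E).tangent ∞
      (fun p : L => (⟨p, P.fundamental ξ p⟩ : TangentBundle 𝓘(ℝ, E) L)) :=
  P.smooth_toFun.comp (contMDiff_id.prodMk contMDiff_const)

lemma fundamental_smul (a : ℝ) (ξ : 𝔩) :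
    P.fundamental (a • ξ) = a • (P.fundamental ξ : ∀ p : L, TangentSpace 𝓘(ℝ, E) p) := by
  funext p
  exact (P.ρ p).map_smul a ξ

variable {P}

lemma IsComplete.flow_zero (hP : P.IsComplete) (ξ : 𝔩) (s : L) : P.flow ξ 0 s = s := by
  rw [flow, dif_pos (hP ξ s)]
  exact (hP ξ s).choose_spec.1

lemma IsComplete.isMIntegralCurve_flow (hP : P.IsComplete) (ξ : 𝔩) (s : L) :
    IsMIntegralCurve (fun t => P.flow ξ t s) (P.fundamental ξ) := by
  have : (fun t => P.flow ξ t s) = (hP ξ s).choose := by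
    funext t
    rw [flow, dif_pos (hP ξ s)]
  rw [this]
  exact (hP ξ s).choose_spec.2

variable [T2Space L]

lemma IsComplete.eq_flow (hP : P.IsComplete) {ξ : 𝔩} {c : ℝ → L}
    (hc : IsMIntegralCurve c (P.fundamental ξ)) (t : ℝ) : c t = P.flow ξ t (c 0) := by
  have := isMIntegralCurve_Ioo_eq_of_contMDiff_boundaryless (t₀ := 0)
    ((P.contMDiff_fundamental ξ).of_le (by simp)) hc (hP.isMIntegralCurve_flow ξ (c 0))
    (hP.flow_zero ξ (c 0)).symm
  exact congrFun this t

/-- Rescaling time by `t` turns an integral curve of `ρ(ξ)` into one of `ρ(tξ)`; uniqueness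
identifies the two at time `1`. -/
lemma IsComplete.act_smul (hP : P.IsComplete) (t : ℝ) (ξ : 𝔩) (s : L) :
    P.act (t • ξ) s = P.flow ξ t s := by
  have h := (hP.isMIntegralCurve_flow ξ s).comp_mul t
  rw [← P.fundamental_smul] at h
  have := hP.eq_flow h 1
  simp only [Function.comp_def, zero_mul, one_mul, hP.flow_zero] at this
  exact this.symm

lemma IsComplete.flow_add (hP : P.IsComplete) (ξ : 𝔩) (a b : ℝ) (s : L) :
    P.flow ξ (a + b) s = P.flow ξ a (P.flow ξ b s) := by
  have := hP.eq_flow ((hP.isMIntegralCurve_flow ξ s).comp_add b) a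
  simpa using this

lemma IsComplete.act_zero (hP : P.IsComplete) (s : L) : P.act 0 s = s := by
  rw [← zero_smul ℝ (0 : 𝔩), hP.act_smul, hP.flow_zero]

omit [T2Space L] in
lemma IsComplete.hasMFDerivAt_flow (hP : P.IsComplete) (ξ : 𝔩) (s : L) (t : ℝ) :
    HasMFDerivAt 𝓘(ℝ, ℝ) 𝓘(ℝ, E) (fun t => P.flow ξ t s) t
      (ContinuousLinearMap.smulRight (1 : ℝ →L[ℝ] ℝ) (P.fundamental ξ (P.flow ξ t s))) :=
  hP.isMIntegralCurve_flow ξ s t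

omit [T2Space L] in
/-- The pull-back of the fundamental fields along a local diffeomorphism from a vector space. -/
lemma contDiffAt_mpullback_fundamental {V : Type*} [NormedAddCommGroup V] [NormedSpace ℝ V]
    [CompleteSpace V] (ξ : 𝔩) {f : V → L} {x : V} (hf : ContMDiffAt 𝓘(ℝ, V) 𝓘(ℝ, E) ∞ f x)
    (hf' : (mfderiv 𝓘(ℝ, V) 𝓘(ℝ, E) f x).IsInvertible) :
    ContDiffAt ℝ ∞ (VectorField.mpullback 𝓘(ℝ, V) 𝓘(ℝ, E) f (P.fundamental ξ)) x :=
  contMDiffAt_vectorSpace_iff_contDiffAt.1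
    (ContMDiffAt.mpullback_vectorField_preimage (P.contMDiff_fundamental ξ (f x)) hf hf' (by simp))

omit [T2Space L] in
/-- An integral curve of a pulled back fundamental field is mapped to an integral curve. -/
lemma isMIntegralCurveOn_comp {V : Type*} [NormedAddCommGroup V] [NormedSpace ℝ V]
    {ξ : 𝔩} {f : V → L} {S : Set V}
    (hf : ∀ x ∈ S, MDifferentiableAt 𝓘(ℝ, V) 𝓘(ℝ, E) f x ∧
      (mfderiv 𝓘(ℝ, V) 𝓘(ℝ, E) f x).IsInvertible) {c : ℝ → V} {T : Set ℝ}
    (hc : ∀ t ∈ T, c t ∈ S ∧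
      HasDerivAt c (VectorField.mpullback 𝓘(ℝ, V) 𝓘(ℝ, E) f (P.fundamental ξ) (c t)) t) :
    IsMIntegralCurveOn (f ∘ c) (P.fundamental ξ) T := by
  intro t ht
  obtain ⟨hS, hd⟩ := hc t ht
  obtain ⟨h1, h2⟩ := hf _ hS
  have hd' : HasMFDerivAt 𝓘(ℝ, ℝ) 𝓘(ℝ, V) c t _ :=
    hasMFDerivAt_iff_hasFDerivAt.2 hd.hasFDerivAt
  refine ((h1.hasMFDerivAt.comp t hd').congr_mfderiv ?_).hasMFDerivWithinAt
  ext
  change mfderiv 𝓘(ℝ, V) 𝓘(ℝ, E) f (c t) ((1 : ℝ) •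
    VectorField.mpullback 𝓘(ℝ, V) 𝓘(ℝ, E) f (P.fundamental ξ) (c t)) =
      (1 : ℝ) • P.fundamental ξ (f (c t))
  rw [one_smul, one_smul, VectorField.mpullback_apply, h2.self_apply_inverse]

variable [FiniteDimensional ℝ E] [FiniteDimensional ℝ 𝔩]

/-- The product `ξ · p` is smooth near `ξ = 0`. -/
theorem IsComplete.contMDiffAt_act_zero (hP : P.IsComplete) (p₀ : L) :
    ContMDiffAt (𝓘(ℝ, 𝔩).prod 𝓘(ℝ, E)) 𝓘(ℝ, E) ∞ (fun q : 𝔩 × L => P.act q.1 q.2) (0, p₀) := by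
  have : CompleteSpace E := FiniteDimensional.complete ℝ E
  have : CompleteSpace 𝔩 := FiniteDimensional.complete ℝ 𝔩
  let e := extChartAt 𝓘(ℝ, E) p₀
  have he : ∀ x ∈ e.target, ContMDiffAt 𝓘(ℝ, E) 𝓘(ℝ, E) ∞ e.symm x := fun x hx =>
    (contMDiffOn_extChartAt_symm p₀).contMDiffAt
      ((isOpen_extChartAt_target p₀).mem_nhds hx)
  have he' : ∀ x ∈ e.target, (mfderiv 𝓘(ℝ, E) 𝓘(ℝ, E) e.symm x).IsInvertible := fun x hx => by
    have := isInvertible_mfderivWithin_extChartAt_symm (I := 𝓘(ℝ, E)) (x := p₀) hx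
    rwa [ModelWithCorners.range_eq_univ, mfderivWithin_univ] at this
  -- The fundamental fields read in the chart, linear in `ξ`. As `𝔩` is finite-dimensional,
  -- smoothness of `X` can be checked for each `ξ` separately.
  let X : E → 𝔩 →L[ℝ] E := fun x =>
    LinearMap.toContinuousLinearMap
      (((mfderiv 𝓘(ℝ, E) 𝓘(ℝ, E) e.symm x).inverse : _ →ₗ[ℝ] TangentSpace 𝓘(ℝ, E) x) ∘ₗ
        (P.ρ (e.symm x) : 𝔩 →ₗ[ℝ] TangentSpace 𝓘(ℝ, E) (e.symm x)))
  have hXeq : ∀ x ξ, X x ξ =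
      VectorField.mpullback 𝓘(ℝ, E) 𝓘(ℝ, E) e.symm (P.fundamental ξ) x := fun x ξ => rfl
  have hX : ContDiffOn ℝ ∞ X e.target := by
    rw [contDiffOn_clm_apply]
    intro ξ x hx
    exact (contDiffAt_mpullback_fundamental ξ (he x hx) (he' x hx)).contDiffWithinAt
  have hU : e.target ∈ 𝓝 (e p₀) := extChartAt_target_mem_nhds p₀
  obtain ⟨φ, hφ, hsol⟩ := exists_contDiffAt_flow X hU hX
  have hmap : ContMDiffAt (𝓘(ℝ, 𝔩).prod 𝓘(ℝ, E)) 𝓘(ℝ, E × 𝔩) ∞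
      (fun q : 𝔩 × L => (e q.2, q.1)) (0, p₀) := by
    rw [modelWithCornersSelf_prod, ← chartedSpaceSelf_prod]
    exact (ContMDiffAt.comp (g := e) (0, p₀) (contMDiffAt_extChartAt (I := 𝓘(ℝ, E)))
      contMDiffAt_snd).prodMk contMDiffAt_fst
  have hev := hmap.continuousAt.eventually (hsol _ hU)
  have heq : (fun q : 𝔩 × L => P.act q.1 q.2) =ᶠ[𝓝 (0, p₀)]
      fun q => e.symm (φ (e q.2, q.1) 1) := by
    have hsrc : ∀ᶠ q in 𝓝 ((0 : 𝔩), p₀), q.2 ∈ e.source :=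
      continuousAt_snd.eventually_mem (extChartAt_source_mem_nhds p₀)
    filter_upwards [hev, hsrc] with q hq hqs
    obtain ⟨h0, ht⟩ := hq
    -- The chart solution becomes an integral curve on an interval containing `0` and `1`, so by
    -- uniqueness it agrees with the global flow at time `1`.
    have hc : IsMIntegralCurveOn (e.symm ∘ φ (e q.2, q.1)) (P.fundamental q.1) (Ioo (-2) 2) :=
      isMIntegralCurveOn_comp (S := e.target)
        (fun x hx => ⟨(he x hx).mdifferentiableAt (by simp), he' x hx⟩) ht
    have := isMIntegralCurveOn_Ioo_eqOn_of_contMDiff_boundaryless (t₀ := 0) (by norm_num)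
      ((P.contMDiff_fundamental q.1).of_le (by simp)) hc
      ((hP.isMIntegralCurve_flow q.1 q.2).isMIntegralCurveOn _)
      (by simp only [Function.comp_apply, h0, hP.flow_zero]; exact e.left_inv hqs)
    exact (this (show (1 : ℝ) ∈ Ioo (-2 : ℝ) 2 by norm_num)).symm
  refine ContMDiffAt.congr_of_eventuallyEq ?_ heq
  have h1 : φ (e p₀, 0) 1 ∈ e.target := by
    have h2 := hev.self_of_nhds.2 1 (by norm_num)
    exact h2.1
  exact ContMDiffAt.comp (g := e.symm) (f := fun q : 𝔩 × L => φ (e q.2, q.1) 1) (0, p₀) (he _ h1)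
    (ContMDiffAt.comp (g := fun q : E × 𝔩 => φ q 1) (0, p₀) hφ.contMDiffAt hmap)

end Parallelization

/-! ### The inverse function theorem as a partial diffeomorphism -/

/-- The inverse function theorem, as a partial diffeomorphism. -/
theorem ContDiffOn.exists_partialDiffeomorph {V W : Type*} [NormedAddCommGroup V] [NormedSpace ℝ V]
    [CompleteSpace V] [NormedAddCommGroup W] [NormedSpace ℝ W] {f : V → W} {S : Set V}
    (hf : ContDiffOn ℝ ∞ f S) (hS : IsOpen S) {x : V} (hx : x ∈ S) (f' : V ≃L[ℝ] W)
    (hf' : HasFDerivAt f (f' : V →L[ℝ] W) x) :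
    ∃ Ψ : PartialDiffeomorph 𝓘(ℝ, V) 𝓘(ℝ, W) V W ∞,
      x ∈ Ψ.source ∧ Ψ.source ⊆ S ∧ EqOn f Ψ Ψ.source := by
  have hn : (∞ : WithTop ℕ∞) ≠ 0 := by simp
  have hfx : ContDiffAt ℝ ∞ f x := hf.contDiffAt (hS.mem_nhds hx)
  let h := hfx.toOpenPartialHomeomorph f hf' hn
  have hh : (h : V → W) = f := hfx.toOpenPartialHomeomorph_coe hf' hn
  have hdc : ContinuousOn (fderiv ℝ f) S := hf.continuousOn_fderiv_of_isOpen hS (by simp)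
  -- Invertible operators form an open set, so the source can be shrunk until the derivative is
  -- invertible at each of its points. This makes the inverse smooth on the whole target.
  have hev : ∀ᶠ y in 𝓝 x, y ∈ S ∧ ∃ g : V ≃L[ℝ] W, HasFDerivAt f (g : V →L[ℝ] W) y := by
    have h1 : ∀ᶠ y in 𝓝 x, fderiv ℝ f y ∈ range ((↑) : (V ≃L[ℝ] W) → V →L[ℝ] W) := by
      refine (hdc.continuousAt (hS.mem_nhds hx)).eventually_mem ?_
      rw [hf'.fderiv]
      exact f'.nhds
    filter_upwards [h1, hS.mem_nhds hx] with y hy hyS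
    obtain ⟨g, hg⟩ := hy
    refine ⟨hyS, g, ?_⟩
    rw [hg]
    exact ((hf.contDiffAt (hS.mem_nhds hyS)).differentiableAt hn).hasFDerivAt
  obtain ⟨S', hS', hS'o, hxS'⟩ := eventually_nhds_iff.1 hev
  let h' := h.restrOpen S' hS'o
  have hsrc : h'.source ⊆ S' := by
    rw [h.restrOpen_source]; exact inter_subset_right
  have hh' : (h' : V → W) = f := by rw [← hh]; rfl
  let Ψ : PartialDiffeomorph 𝓘(ℝ, V) 𝓘(ℝ, W) V W ∞ :=
    { toPartialEquiv := h'.toPartialEquiv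
      open_source := h'.open_source
      open_target := h'.open_target
      contMDiffOn_toFun := by
        change ContMDiffOn 𝓘(ℝ, V) 𝓘(ℝ, W) ∞ h' h'.source
        rw [hh', contMDiffOn_iff_contDiffOn]
        exact hf.mono fun y hy => (hS' y (hsrc hy)).1
      contMDiffOn_invFun := by
        change ContMDiffOn 𝓘(ℝ, W) 𝓘(ℝ, V) ∞ h'.symm h'.target
        rw [contMDiffOn_iff_contDiffOn]
        intro z hz
        obtain ⟨hyS, g, hg⟩ := hS' _ (hsrc (h'.map_target hz))
        refine (h'.contDiffAt_symm hz (f₀' := g) ?_ ?_).contDiffWithinAt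
        · rw [hh']; exact hg
        · rw [hh']; exact hf.contDiffAt (hS.mem_nhds hyS) }
  refine ⟨Ψ, ?_, fun y hy => (hS' y (hsrc hy)).1, fun y _ => ?_⟩
  · change x ∈ h'.source
    rw [h.restrOpen_source]
    exact ⟨hfx.mem_toOpenPartialHomeomorph_source hf' hn, hxS'⟩
  · exact (congrFun hh' y).symm

/-! ### Global smoothness of the product, the right product maps and the bracket -/

namespace Parallelization

variable {E : Type*} [NormedAddCommGroup E] [NormedSpace ℝ E]
  {L : Type*} [TopologicalSpace L] [ChartedSpace E L] [IsManifold 𝓘(ℝ, E) ∞ L]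
  {𝔩 : Type*} [NormedAddCommGroup 𝔩] [NormedSpace ℝ 𝔩]
  {P : Parallelization E L 𝔩}

variable [T2Space L] [FiniteDimensional ℝ E] [FiniteDimensional ℝ 𝔩]

/-- The product `ξ · p` is smooth. -/
theorem IsComplete.contMDiff_act (hP : P.IsComplete) :
    ContMDiff (𝓘(ℝ, 𝔩).prod 𝓘(ℝ, E)) 𝓘(ℝ, E) ∞ (fun q : 𝔩 × L => P.act q.1 q.2) := by
  -- Only for finite order does regularity at a point spread to a neighbourhood, which the
  -- compactness argument needs.
  rw [contMDiff_infty]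
  rintro n ⟨ξ₀, p₀⟩
  let K := (fun t => P.flow ξ₀ t p₀) '' Icc (0 : ℝ) 1
  have hK : IsCompact K :=
    isCompact_Icc.image_of_continuousOn (hP.isMIntegralCurve_flow ξ₀ p₀).continuous.continuousOn
  -- By compactness of the orbit segment one neighbourhood of `0` serves all its points. It contains
  -- `a • ξ₀` for some `a = 1 / (N + 1)`, and the time-one flow of `ξ` is `N + 1` steps of the flow
  -- of `a • ξ`.
  have hev : ∀ᶠ ζ in 𝓝 (0 : 𝔩), ∀ q ∈ K,
      ContMDiffAt (𝓘(ℝ, 𝔩).prod 𝓘(ℝ, E)) 𝓘(ℝ, E) n (fun q : 𝔩 × L => P.act q.1 q.2) (ζ, q) := by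
    refine hK.eventually_forall_of_forall_eventually fun q _ => ?_
    have : IsManifold 𝓘(ℝ, E) n L := IsManifold.of_le (n := ∞) (by exact_mod_cast le_top)
    have h := contMDiffAt_infty.1 (hP.contMDiffAt_act_zero q) n
    exact (contMDiffAt_iff_contMDiffAt_nhds (by simp)).1 h
  have htend : Tendsto (fun N : ℕ => ((N : ℝ) + 1)⁻¹ • ξ₀) atTop (𝓝 0) := by
    have := (tendsto_one_div_add_atTop_nhds_zero_nat (𝕜 := ℝ)).smul_const ξ₀
    simpa using this
  obtain ⟨N, hN⟩ := (htend.eventually hev).exists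
  set a : ℝ := ((N : ℝ) + 1)⁻¹ with ha
  have ha0 : 0 ≤ a := by positivity
  have hflow : ∀ (k : ℝ) (ξ : 𝔩) (p : L), P.flow (a • ξ) k p = P.flow ξ (k * a) p := fun k ξ p => by
    rw [← hP.act_smul, smul_smul, hP.act_smul]
  have key : ∀ k : ℕ, k ≤ N + 1 → ContMDiffAt (𝓘(ℝ, 𝔩).prod 𝓘(ℝ, E)) 𝓘(ℝ, E) n
      (fun q : 𝔩 × L => P.flow (a • q.1) k q.2) (ξ₀, p₀) := by
    intro k
    induction k with
    | zero =>
      intro _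
      simp only [Nat.cast_zero, hP.flow_zero]
      exact contMDiffAt_snd
    | succ k ih =>
      intro hk
      have hmem : P.flow (a • ξ₀) k p₀ ∈ K := by
        rw [hflow]
        refine ⟨k * a, ⟨by positivity, ?_⟩, rfl⟩
        rw [ha, ← div_eq_mul_inv, div_le_one (by positivity)]
        exact_mod_cast (Nat.le_succ k).trans hk
      have h1 : ContMDiffAt (𝓘(ℝ, 𝔩).prod 𝓘(ℝ, E)) 𝓘(ℝ, 𝔩) n
          (fun q : 𝔩 × L => a • q.1) (ξ₀, p₀) :=
        ContMDiffAt.comp (g := fun ξ : 𝔩 => a • ξ) (ξ₀, p₀)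
          (contDiff_const_smul a).contMDiff.contMDiffAt contMDiffAt_fst
      have h2 := ContMDiffAt.comp (g := fun q : 𝔩 × L => P.act q.1 q.2)
        (f := fun q : 𝔩 × L => (a • q.1, P.flow (a • q.1) k q.2)) (ξ₀, p₀)
        (hN _ hmem) (h1.prodMk (ih ((Nat.le_succ k).trans hk)))
      refine h2.congr_of_eventuallyEq (Eventually.of_forall fun q => ?_)
      simp only [Function.comp_apply, Nat.cast_succ]
      rw [add_comm, hP.flow_add]
      rfl
  refine (key (N + 1) le_rfl).congr_of_eventuallyEq (Eventually.of_forall fun q => ?_)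
  simp only [hflow]
  have : ((N + 1 : ℕ) : ℝ) * a = 1 := by
    rw [ha]; push_cast; exact mul_inv_cancel₀ (by positivity)
  rw [this]
  rfl

lemma IsComplete.contMDiff_rightMul (hP : P.IsComplete) (s : L) :
    ContMDiff 𝓘(ℝ, 𝔩) 𝓘(ℝ, E) ∞ (P.rightMul s) :=
  hP.contMDiff_act.comp (contMDiff_id.prodMk contMDiff_const)

omit [FiniteDimensional ℝ E] [FiniteDimensional ℝ 𝔩] in
lemma rightMul_zero (hP : P.IsComplete) (s : L) : P.rightMul s 0 = s := hP.act_zero s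

omit [FiniteDimensional ℝ E] [FiniteDimensional ℝ 𝔩] in
/-- The derivative of a function along the product. -/
lemma IsComplete.hasDerivAt_comp_act (hP : P.IsComplete) {W : Type*} [NormedAddCommGroup W]
    [NormedSpace ℝ W] {f : L → W} {p : L} (hf : MDifferentiableAt 𝓘(ℝ, E) 𝓘(ℝ, W) f p) (ξ : 𝔩) :
    HasDerivAt (fun t : ℝ => f (P.act (t • ξ) p))
      (mfderiv 𝓘(ℝ, E) 𝓘(ℝ, W) f p (P.fundamental ξ p)) 0 := by
  simp only [hP.act_smul]
  have h0 : P.flow ξ 0 p = p := hP.flow_zero ξ p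
  have h1 := hP.hasMFDerivAt_flow ξ p 0
  have h2 : HasMFDerivAt 𝓘(ℝ, E) 𝓘(ℝ, W) f (P.flow ξ 0 p)
    (mfderiv 𝓘(ℝ, E) 𝓘(ℝ, W) f (P.flow ξ 0 p)) := by
    rw [h0]; exact hf.hasMFDerivAt
  let D : ℝ →L[ℝ] W := (mfderiv 𝓘(ℝ, E) 𝓘(ℝ, W) f (P.flow ξ 0 p)).comp
    (ContinuousLinearMap.smulRight (1 : ℝ →L[ℝ] ℝ) (P.fundamental ξ (P.flow ξ 0 p)))
  have h3 : HasFDerivAt (fun t => f (P.flow ξ t p)) D 0 :=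
    hasMFDerivAt_iff_hasFDerivAt.1 (h2.comp (0 : ℝ) h1)
  have h4 : D 1 = mfderiv 𝓘(ℝ, E) 𝓘(ℝ, W) f p (P.fundamental ξ p) := by
    change mfderiv 𝓘(ℝ, E) 𝓘(ℝ, W) f (P.flow ξ 0 p) ((1 : ℝ) • P.fundamental ξ (P.flow ξ 0 p)) = _
    rw [one_smul, h0]
  exact h4 ▸ h3.hasDerivAt

/-- The right product map is a local diffeomorphism at `0`. -/
theorem IsComplete.isLocalDiffeomorphAt_rightMul (hP : P.IsComplete) (s : L) :
    IsLocalDiffeomorphAt 𝓘(ℝ, 𝔩) 𝓘(ℝ, E) ∞ (P.rightMul s) 0 := by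
  have : CompleteSpace E := FiniteDimensional.complete ℝ E
  have : CompleteSpace 𝔩 := FiniteDimensional.complete ℝ 𝔩
  let e := extChartAt 𝓘(ℝ, E) s
  have hR := hP.contMDiff_rightMul s
  let S : Set 𝔩 := P.rightMul s ⁻¹' e.source
  have hS : IsOpen S := (isOpen_extChartAt_source s).preimage hR.continuous
  have h0S : (0 : 𝔩) ∈ S := by
    change P.rightMul s 0 ∈ e.source
    rw [rightMul_zero hP]
    exact mem_extChartAt_source s
  let f : 𝔩 → E := e ∘ P.rightMul s
  have hf : ContDiffOn ℝ ∞ f S := by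
    rw [← contMDiffOn_iff_contDiffOn]
    exact (contMDiffOn_extChartAt (I := 𝓘(ℝ, E)) (n := ∞) (x := s)).comp hR.contMDiffOn
      fun y hy => by
        rw [← extChartAt_source 𝓘(ℝ, E)]; exact hy
  have hfd : HasFDerivAt f (fderiv ℝ f 0) 0 :=
    ((hf.contDiffAt (hS.mem_nhds h0S)).differentiableAt (by simp)).hasFDerivAt
  have hed : MDifferentiableAt 𝓘(ℝ, E) 𝓘(ℝ, E) e s :=
    (contMDiffAt_extChartAt (I := 𝓘(ℝ, E)) (n := ∞)).mdifferentiableAt (by simp)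
  -- The curve `t ↦ (tξ) · s` has velocity `ρ_s ξ` at `0`, so `R_s` has derivative `ρ_s` there, an
  -- isomorphism.
  have hval : ∀ ξ, fderiv ℝ f 0 ξ = mfderiv 𝓘(ℝ, E) 𝓘(ℝ, E) e s (P.ρ s ξ) := fun ξ => by
    have hz : (fun t : ℝ => t • ξ) 0 = 0 := zero_smul ℝ ξ
    have hfd' := hfd
    rw [← hz] at hfd'
    have h1 := HasFDerivAt.hasDerivAt_comp_curve (c := fun t : ℝ => t • ξ) hfd'
      (IsLocalUnitalProduct.hasDerivAt_smul_zero ξ)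
    rw [hz] at h1
    exact h1.unique (hP.hasDerivAt_comp_act hed ξ)
  have hinv : (mfderiv 𝓘(ℝ, E) 𝓘(ℝ, E) e s).IsInvertible :=
    isInvertible_mfderiv_extChartAt (mem_extChartAt_source s)
  have hbij : Function.Bijective (fderiv ℝ f 0) := by
    have : (fderiv ℝ f 0 : 𝔩 → E) = (mfderiv 𝓘(ℝ, E) 𝓘(ℝ, E) e s) ∘ (P.ρ s) := funext hval
    rw [this]
    exact hinv.bijective.comp (P.ρ s).bijective
  let f' : 𝔩 ≃L[ℝ] E := (LinearEquiv.ofBijective (fderiv ℝ f 0 : 𝔩 →ₗ[ℝ] E)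
    hbij).toContinuousLinearEquiv
  have hf' : HasFDerivAt f (f' : 𝔩 →L[ℝ] E) 0 := hfd.congr_fderiv (by ext; rfl)
  obtain ⟨Ψ, h0Ψ, hΨS, hΨ⟩ := hf.exists_partialDiffeomorph hS h0S f' hf'
  let χ : PartialDiffeomorph 𝓘(ℝ, E) 𝓘(ℝ, E) E L ∞ :=
    { toPartialEquiv := e.symm
      open_source := isOpen_extChartAt_target s
      open_target := isOpen_extChartAt_source s
      contMDiffOn_toFun := contMDiffOn_extChartAt_symm s
      contMDiffOn_invFun := by
        simpa [e] using contMDiffOn_extChartAt (I := 𝓘(ℝ, E)) (n := ∞) (x := s) }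
  have hmem : ∀ y ∈ Ψ.source, Ψ y ∈ χ.source := fun y hy => by
    rw [← hΨ hy]
    exact e.map_source (hΨS hy)
  refine ⟨Ψ.trans χ, ⟨h0Ψ, hmem 0 h0Ψ⟩, fun y hy => ?_⟩
  change P.rightMul s y = e.symm (Ψ y)
  rw [← hΨ hy.1]
  exact (e.left_inv (hΨS hy.1)).symm

omit [T2Space L] [FiniteDimensional ℝ 𝔩] in
/-- The bracket functions are smooth. -/
theorem contMDiff_bracket (P : Parallelization E L 𝔩) (ξ η : 𝔩) :
    ContMDiff 𝓘(ℝ, E) 𝓘(ℝ, 𝔩) ∞ (fun p : L => P.bracket p ξ η) := by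
  have : CompleteSpace E := FiniteDimensional.complete ℝ E
  have h2 : IsManifold 𝓘(ℝ, E) (minSmoothness ℝ 2) L :=
    IsManifold.of_le (n := ∞) (by simpa using two_le_contDiff_infty)
  have h3 : IsManifold 𝓘(ℝ, E) (((⊤ : ℕ∞) : WithTop ℕ∞) + 1) L := by
    rw [show (((⊤ : ℕ∞) : WithTop ℕ∞) + 1) = ∞ from rfl]; infer_instance
  have h := ContDiff.mlieBracket_vectorField (m := ⊤) (n := ⊤) (P.contMDiff_fundamental ξ)
    (P.contMDiff_fundamental η) (by simp)
  have h4 := contMDiff_snd.comp (P.smooth_invFun.comp h)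
  exact contDiff_neg.contMDiff.comp h4

end Parallelization

/-! ### The loop product and its structure equation -/

lemma VectorField.mlieBracket_apply_eq_fderiv {V : Type*} [NormedAddCommGroup V] [NormedSpace ℝ V]
    (X Y : ∀ x : V, TangentSpace 𝓘(ℝ, V) x) (x : V) :
    mlieBracket 𝓘(ℝ, V) X Y x =
      fderiv ℝ (Y : V → V) x (X x) - fderiv ℝ (X : V → V) x (Y x) := by
  rw [← mlieBracketWithin_univ, mlieBracketWithin_eq_lieBracketWithin]
  exact congrFun (lieBracketWithin_univ (𝕜 := ℝ) (V := (X : V → V)) (W := (Y : V → V))) x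

namespace Parallelization

variable {E : Type*} [NormedAddCommGroup E] [NormedSpace ℝ E]
  {L : Type*} [TopologicalSpace L] [ChartedSpace E L] [IsManifold 𝓘(ℝ, E) ∞ L]
  {𝔩 : Type*} [NormedAddCommGroup 𝔩] [NormedSpace ℝ 𝔩]
  {P : Parallelization E L 𝔩} {s : L} {Φ : PartialDiffeomorph 𝓘(ℝ, 𝔩) 𝓘(ℝ, E) 𝔩 L ∞}

lemma IsLocalInversion.source_mem_nhds (hΦ : P.IsLocalInversion s Φ) : Φ.source ∈ 𝓝 0 :=
  Φ.open_source.mem_nhds hΦ.1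

lemma IsLocalInversion.symm_rightMul (hΦ : P.IsLocalInversion s Φ) {x : 𝔩} (hx : x ∈ Φ.source) :
    Φ.symm (P.act x s) = x := by
  change Φ.symm (P.rightMul s x) = x
  rw [hΦ.2 hx]
  exact Φ.left_inv hx

omit [IsManifold 𝓘(ℝ, E) ∞ L] in
lemma contMDiffAt_symm {x : 𝔩} (hx : x ∈ Φ.source) :
    ContMDiffAt 𝓘(ℝ, E) 𝓘(ℝ, 𝔩) ∞ Φ.symm (Φ x) :=
  Φ.contMDiffOn_invFun.contMDiffAt (Φ.open_target.mem_nhds (Φ.map_source hx))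

omit [IsManifold 𝓘(ℝ, E) ∞ L] in
lemma contMDiffAt_partialDiffeomorph {x : 𝔩} (hx : x ∈ Φ.source) :
    ContMDiffAt 𝓘(ℝ, 𝔩) 𝓘(ℝ, E) ∞ Φ x :=
  Φ.contMDiffOn_toFun.contMDiffAt (Φ.open_source.mem_nhds hx)

omit [IsManifold 𝓘(ℝ, E) ∞ L] in
lemma isInvertible_mfderiv {x : 𝔩} (hx : x ∈ Φ.source) :
    (mfderiv 𝓘(ℝ, 𝔩) 𝓘(ℝ, E) Φ x).IsInvertible :=
  ⟨(Φ.isLocalDiffeomorphAt _ _ _ hx).mfderivToContinuousLinearEquiv (by simp), rfl⟩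

omit [IsManifold 𝓘(ℝ, E) ∞ L] in
-- Differentiate `Φ.symm ∘ Φ = id` near `x`.
lemma mfderiv_symm_apply {x : 𝔩} (hx : x ∈ Φ.source) (v : TangentSpace 𝓘(ℝ, E) (Φ x)) :
    mfderiv 𝓘(ℝ, E) 𝓘(ℝ, 𝔩) Φ.symm (Φ x) v = (mfderiv 𝓘(ℝ, 𝔩) 𝓘(ℝ, E) Φ x).inverse v := by
  have h1 := ((contMDiffAt_symm hx).mdifferentiableAt (by simp)).hasMFDerivAt.comp x
    ((contMDiffAt_partialDiffeomorph hx).mdifferentiableAt (by simp)).hasMFDerivAt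
  have h2 : Φ.symm ∘ Φ =ᶠ[𝓝 x] id := by
    filter_upwards [Φ.open_source.mem_nhds hx] with y hy using Φ.left_inv hy
  have h3 := hasMFDerivAt_unique h1 ((hasMFDerivAt_id x).congr_of_eventuallyEq h2)
  have h4 := DFunLike.congr_fun h3 ((mfderiv 𝓘(ℝ, 𝔩) 𝓘(ℝ, E) Φ x).inverse v)
  have h5 : mfderiv 𝓘(ℝ, E) 𝓘(ℝ, 𝔩) Φ.symm (Φ x) (mfderiv 𝓘(ℝ, 𝔩) 𝓘(ℝ, E) Φ x
      ((mfderiv 𝓘(ℝ, 𝔩) 𝓘(ℝ, E) Φ x).inverse v)) =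
      (mfderiv 𝓘(ℝ, 𝔩) 𝓘(ℝ, E) Φ x).inverse v := h4
  rwa [(isInvertible_mfderiv hx).self_apply_inverse] at h5

variable [T2Space L]

lemma IsLocalInversion.apply_zero (hP : P.IsComplete) (hΦ : P.IsLocalInversion s Φ) : Φ 0 = s := by
  rw [← hΦ.2 hΦ.1]
  exact hP.act_zero s

variable [FiniteDimensional ℝ E] [FiniteDimensional ℝ 𝔩]

/-- The loop product is a smooth local product with unit `0`. -/
theorem IsLocalInversion.isLocalUnitalProduct (hP : P.IsComplete) (hΦ : P.IsLocalInversion s Φ) :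
    IsLocalUnitalProduct (fun x : 𝔩 × 𝔩 => P.loopMul s Φ x.1 x.2) where
  contDiffAt := by
    rw [← contMDiffAt_iff_contDiffAt]
    have h1 : ContMDiff 𝓘(ℝ, 𝔩 × 𝔩) (𝓘(ℝ, 𝔩).prod 𝓘(ℝ, E)) ∞
        (fun x : 𝔩 × 𝔩 => (x.1, P.rightMul s x.2)) :=
      contDiff_fst.contMDiff.prodMk ((hP.contMDiff_rightMul s).comp contDiff_snd.contMDiff)
    have h2 := hP.contMDiff_act.comp h1
    have h3 : P.act 0 (P.rightMul s 0) = Φ 0 := by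
      rw [hP.act_zero, rightMul_zero hP, hΦ.apply_zero hP]
    have h4 := contMDiffAt_symm hΦ.1
    rw [← h3] at h4
    exact ContMDiffAt.comp (g := Φ.symm) ((0 : 𝔩), (0 : 𝔩)) h4 h2.contMDiffAt
  mul_zero := by
    filter_upwards [hΦ.source_mem_nhds] with x hx
    simp only [loopMul, hP.act_zero]
    exact hΦ.symm_rightMul hx
  zero_mul := by
    filter_upwards [hΦ.source_mem_nhds] with x hx
    simp only [loopMul, hP.act_zero]
    exact hΦ.symm_rightMul hx

open IsLocalUnitalProduct

/-- The link between product and geometry: `t ↦ (tξ) · (y · s)` is the integral curve of `ρ(ξ)`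
through `Φ y`, and `Φ.symm` carries it to `t ↦ (tξ) ∘_s y`. Compare velocities at `t = 0`. -/
lemma IsLocalInversion.eventually_leftDeriv (hP : P.IsComplete) (hΦ : P.IsLocalInversion s Φ) :
    ∀ᶠ y in 𝓝 0, ∀ ξ : 𝔩, leftDeriv (fun x : 𝔩 × 𝔩 => P.loopMul s Φ x.1 x.2) y ξ =
      VectorField.mpullback 𝓘(ℝ, 𝔩) 𝓘(ℝ, E) Φ (P.fundamental ξ) y := by
  filter_upwards [(hΦ.isLocalUnitalProduct hP).eventually_hasDerivAt_left,
    hΦ.source_mem_nhds] with y hy hys ξ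
  have h1 := hP.hasDerivAt_comp_act ((contMDiffAt_symm hys).mdifferentiableAt (by simp)) ξ
  rw [VectorField.mpullback_apply, ← mfderiv_symm_apply hys]
  refine (hy ξ).unique ?_
  have h2 : P.act y s = Φ y := hΦ.2 hys
  simpa only [loopMul, h2] using h1

/-- The structure equation of the frame of left derivatives of the loop product. -/
lemma IsLocalInversion.eventually_leftDeriv_bracket (hP : P.IsComplete)
    (hΦ : P.IsLocalInversion s Φ) (ξ η : 𝔩) :
    ∀ᶠ y in 𝓝 0,
      leftDeriv (fun x : 𝔩 × 𝔩 => P.loopMul s Φ x.1 x.2) y (P.bracket (Φ y) ξ η) =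
      fderiv ℝ (leftDeriv fun x : 𝔩 × 𝔩 => P.loopMul s Φ x.1 x.2) y
        (leftDeriv (fun x : 𝔩 × 𝔩 => P.loopMul s Φ x.1 x.2) y η) ξ -
      fderiv ℝ (leftDeriv fun x : 𝔩 × 𝔩 => P.loopMul s Φ x.1 x.2) y
        (leftDeriv (fun x : 𝔩 × 𝔩 => P.loopMul s Φ x.1 x.2) y ξ) η := by
  have : CompleteSpace 𝔩 := FiniteDimensional.complete ℝ 𝔩
  have h2 : IsManifold 𝓘(ℝ, E) (minSmoothness ℝ 2) L :=
    IsManifold.of_le (n := ∞) (by simpa using two_le_contDiff_infty)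
  have hA := (hΦ.isLocalUnitalProduct hP).contDiffAt_leftDeriv
  filter_upwards [eventually_eventually_nhds.2 (hΦ.eventually_leftDeriv hP), hΦ.source_mem_nhds,
    hA.eventually_two] with y hy hys hAy
  set A := leftDeriv fun x : 𝔩 × 𝔩 => P.loopMul s Φ x.1 x.2
  have hAd := (hAy.differentiableAt (by simp)).hasFDerivAt
  have hfd : ∀ ζ v, fderiv ℝ (VectorField.mpullback 𝓘(ℝ, 𝔩) 𝓘(ℝ, E) Φ (P.fundamental ζ)) y v =
      fderiv ℝ A y v ζ := fun ζ v => by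
    have he : VectorField.mpullback 𝓘(ℝ, 𝔩) 𝓘(ℝ, E) Φ (P.fundamental ζ) =ᶠ[𝓝 y]
        fun z => A z ζ := by
      filter_upwards [hy] with z hz using (hz ζ).symm
    refine (DFunLike.congr_fun he.fderiv_eq v).trans ?_
    rw [(hAd.clm_apply (hasFDerivAt_const ζ y)).fderiv]
    simp
  have hmd : ∀ ζ, MDifferentiableAt 𝓘(ℝ, E) 𝓘(ℝ, E).tangent
      (fun p : L => (⟨p, P.fundamental ζ p⟩ : TangentBundle 𝓘(ℝ, E) L)) (Φ y) := fun ζ =>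
    (P.contMDiff_fundamental ζ (Φ y)).mdifferentiableAt (by simp)
  -- Pull-back commutes with the Lie bracket, which in the vector space `𝔩` is computed from
  -- derivatives of `A`.
  have hbr := VectorField.mpullback_mlieBracket (n := ∞) (hmd ξ) (hmd η)
    (contMDiffAt_partialDiffeomorph hys) (by simpa using two_le_contDiff_infty)
  have hy0 := hy.self_of_nhds
  have hbr' : VectorField.mpullback 𝓘(ℝ, 𝔩) 𝓘(ℝ, E) Φ
      (VectorField.mlieBracket 𝓘(ℝ, E) (P.fundamental ξ) (P.fundamental η)) y =
      (fderiv ℝ A y (A y ξ) η - fderiv ℝ A y (A y η) ξ : 𝔩) :=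
    hbr.trans ((VectorField.mlieBracket_apply_eq_fderiv _ _ y).trans
      (congrArg₂ (fun a b : 𝔩 => a - b)
        ((hfd η _).trans (congrArg (fun v => fderiv ℝ A y v η) (hy0 ξ).symm))
        ((hfd ξ _).trans (congrArg (fun v => fderiv ℝ A y v ξ) (hy0 η).symm))))
  -- `A y` is the pull-back of `ρ`, so it cancels the `ρ⁻¹` in the definition of the bracket; the
  -- minus sign there exchanges `ξ` and `η` in the final formula.
  have hneg : A y (P.bracket (Φ y) ξ η) = -VectorField.mpullback 𝓘(ℝ, 𝔩) 𝓘(ℝ, E) Φ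
      (VectorField.mlieBracket 𝓘(ℝ, E) (P.fundamental ξ) (P.fundamental η)) y := by
    rw [hy0, VectorField.mpullback_apply, VectorField.mpullback_apply, ← map_neg]
    congr 1
    simp [fundamental, bracket]
  rw [hneg, hbr']
  exact neg_sub (fderiv ℝ A y (A y ξ) η) (fderiv ℝ A y (A y η) ξ)

omit [FiniteDimensional ℝ 𝔩] in
/-- The derivative of the bracket functions in the coordinates given by the right product map. -/
lemma IsLocalInversion.fderiv_bracket (hP : P.IsComplete) (hΦ : P.IsLocalInversion s Φ)
    (ξ η γ : 𝔩) :
    DifferentiableAt ℝ (fun y => P.bracket (Φ y) ξ η) 0 ∧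
      P.skewAssociator s ξ η γ = fderiv ℝ (fun y => P.bracket (Φ y) ξ η) 0 γ := by
  have hd : DifferentiableAt ℝ (fun y => P.bracket (Φ y) ξ η) 0 := by
    rw [← mdifferentiableAt_iff_differentiableAt]
    exact (ContMDiffAt.comp (g := fun p : L => P.bracket p ξ η) (0 : 𝔩)
      (P.contMDiff_bracket ξ η _)
      (contMDiffAt_partialDiffeomorph hΦ.1)).mdifferentiableAt (by simp)
  refine ⟨hd, ?_⟩
  have hz : (fun t : ℝ => t • γ) 0 = 0 := zero_smul ℝ γ
  have hd' := hd.hasFDerivAt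
  rw [← hz] at hd'
  have h1 := HasFDerivAt.hasDerivAt_comp_curve (c := fun t : ℝ => t • γ) hd'
    (hasDerivAt_smul_zero γ)
  rw [hz] at h1
  have h2 := hP.hasDerivAt_comp_act ((P.contMDiff_bracket ξ η s).mdifferentiableAt (by simp)) γ
  refine h2.unique (h1.congr_of_eventuallyEq ?_)
  filter_upwards [(tendsto_smul_zero γ).eventually hΦ.source_mem_nhds] with t ht
  have : P.act (t • γ) s = Φ (t • γ) := hΦ.2 ht
  rw [this]

end Parallelization

end

theorem mainTheorem2
    {E : Type*} [NormedAddCommGroup E] [NormedSpace ℝ E] [FiniteDimensional ℝ E]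
    {L : Type*} [TopologicalSpace L] [T2Space L] [ChartedSpace E L] [IsManifold 𝓘(ℝ, E) ∞ L]
    {𝔩 : Type*} [NormedAddCommGroup 𝔩] [NormedSpace ℝ 𝔩] [FiniteDimensional ℝ 𝔩]
    (P : Parallelization E L 𝔩) (hP : P.IsComplete) (s : L) :
    IsLocalDiffeomorphAt 𝓘(ℝ, 𝔩) 𝓘(ℝ, E) ∞ (P.rightMul s) 0 ∧
    (∀ ξ η : 𝔩, ContMDiff 𝓘(ℝ, E) 𝓘(ℝ, 𝔩) ∞ (fun p : L => P.bracket p ξ η)) ∧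
    ∀ Φ : PartialDiffeomorph 𝓘(ℝ, 𝔩) 𝓘(ℝ, E) 𝔩 L ∞, P.IsLocalInversion s Φ →
      ContDiffAt ℝ ∞ (fun x : 𝔩 × 𝔩 => P.loopMul s Φ x.1 x.2) (0, 0) ∧
      (∀ ξ η : 𝔩, P.bracket s ξ η =
        deriv (fun t₁ : ℝ => deriv (fun t₂ : ℝ =>
          P.loopMul s Φ (t₁ • ξ) (t₂ • η) - P.loopMul s Φ (t₂ • η) (t₁ • ξ)) 0) 0) ∧
      (∀ ξ η γ : 𝔩, P.skewAssociator s ξ η γ =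
        P.infAssociator s Φ ξ η γ - P.infAssociator s Φ η ξ γ) := by
  refine ⟨hP.isLocalDiffeomorphAt_rightMul s, P.contMDiff_bracket, fun Φ hΦ => ?_⟩
  have hm := hΦ.isLocalUnitalProduct hP
  refine ⟨hm.contDiffAt, fun ξ η => ?_, fun ξ η γ => ?_⟩
  · have h := (hΦ.eventually_leftDeriv_bracket hP ξ η).self_of_nhds
    rw [hm.leftDeriv_zero, hΦ.apply_zero hP] at h
    exact h.trans (hm.deriv_deriv_commutator ξ η).symm
  · obtain ⟨hd, h⟩ := hΦ.fderiv_bracket hP ξ η γ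
    rw [h]
    exact hm.associatorDeriv_sub ξ η γ hd (hΦ.eventually_leftDeriv_bracket hP ξ η)
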